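/- Let $\mathbb{D}=\{z\in\mathbb{C}:|z|<1\}$. Let $\phi$ be a Ma–Minda function: $\phi$ is analytic and univalent in $\mathbb{D}$ with positive real part, $\phi(\mathbb{D})$ is symmetric with respect to the real axis and starlike with respect to $\phi(0)=1$, and $\phi'(0)>0$. Write $\phi(z)=1+\sum_{n\ge1}B_nz^n$, and suppose that $B_n>0$ for all $n\ge1$ and that $\phi$ lies in the Hardy class $H^2$. Let $\mathcal{S}$ be the class of univalent analytic functions $f$ in $\mathbb{D}$ with $f(0)=0$ and $f'(0)=1$. Let $\mathcal{S}^*(\phi)$ be the class of all $f\in\mathcal{S}$ with $zf'(z)/f(z)\prec\phi(z)$, that is, $zf'(z)/f(z)=\phi(\omega(z))$ in $\mathbb{D}$ for some analytic $\omega:\mathbb{D}\to\mathbb{D}$ with $\omega(0)=0$ (the left side being $1$ at $z=0$). **Theorem 2.1.** There is a unique function $h\in\mathcal{S}$ with $zh'(z)/h(z)=\phi(z)$ in $\mathbb{D}$; the limit $h(-1):=\lim_{r\to1^-}h(-r)$ exists and is finite; and the equation $h(r)+h(-1)=0$ has a smallest root $r_f$ in $(0,1)$. Every $f(z)=z+\sum_{n\ge2}a_nz^n$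 in $\mathcal{S}^*(\phi)$ satisfies $$r+\sum_{n=2}^{\infty}|a_n|r^n\le d\bigl(f(0),\partial f(\mathbb{D})\bigr)\qquad\text{for } 0\le r\le\min\{r_f,1/3\},$$ where $d$ is the Euclidean distance. If $r_f\le 1/3$, then the radius $r_f$ is best possible: for every $r\in(r_f,1)$ there is an $f(z)=z+\sum_{n\ge2}a_nz^n$ in $\mathcal{S}^*(\phi)$ with $r+\sum_{n\ge2}|a_n|r^n>d(f(0),\partial f(\mathbb{D}))$. -/

import Mathlib

open Filter Topology

namespace MaMinda

/-- The open unit disk of the complex plane. -/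
def disk : Set ℂ := Metric.ball 0 1

/-- The `n`-th Taylor coefficient of `f` at the origin. -/
noncomputable def taylorCoeff (f : ℂ → ℂ) (n : ℕ) : ℂ :=
  iteratedDeriv n f 0 / (n.factorial : ℂ)

/-- Normalized univalent functions: analytic and injective on the disk, with
`f 0 = 0` and `f' 0 = 1`. -/
structure IsClassS (f : ℂ → ℂ) : Prop where
  analytic : DifferentiableOn ℂ f disk
  map_zero : f 0 = 0
  deriv_zero : deriv f 0 = 1
  univalent : Set.InjOn f disk

/-- Subordination `f ≺ g` in the disk: `f = g ∘ ω` on the disk for some analytic self-map `ω` of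
the disk that fixes the origin. -/
def Subordinate (f g : ℂ → ℂ) : Prop :=
  ∃ ω : ℂ → ℂ, DifferentiableOn ℂ ω disk ∧ Set.MapsTo ω disk disk ∧ ω 0 = 0 ∧
    ∀ z ∈ disk, f z = g (ω z)

/-- Ma-Minda functions: analytic and univalent on the disk, with positive real part, and with an
image that is symmetric about the real axis and starlike with respect to `φ 0 = 1`; moreover
`φ' 0` is a positive real number. -/
structure IsMaMinda (φ : ℂ → ℂ) : Prop where
  analytic : DifferentiableOn ℂ φ disk
  univalent : Set.InjOn φ disk
  re_pos : ∀ z ∈ disk, 0 < (φ z).re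
  symmetric : ∀ w ∈ φ '' disk, (starRingEnd ℂ) w ∈ φ '' disk
  starlike : StarConvex ℝ (1 : ℂ) (φ '' disk)
  map_zero : φ 0 = 1
  deriv_zero_re : 0 < (deriv φ 0).re
  deriv_zero_im : (deriv φ 0).im = 0

/-- The function `z f'(z) / f(z)`, with its removable singularity at the origin filled in
(the value there is `1` for a normalized univalent `f`). -/
noncomputable def logDerivQuotient (f : ℂ → ℂ) (z : ℂ) : ℂ :=
  if z = 0 then 1 else z * deriv f z / f z

/-- The Ma-Minda starlike class associated with `φ`. -/
def StarlikeClass (φ : ℂ → ℂ) : Set (ℂ → ℂ) :=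
  {f | IsClassS f ∧ Subordinate (logDerivQuotient f) φ}

/-- The Ma-Minda extremal function of the starlike class: the normalized univalent function `h`
with `z h'(z) / h(z) = φ z` on the disk. -/
def IsExtremal (φ h : ℂ → ℂ) : Prop :=
  IsClassS h ∧ ∀ z ∈ disk, logDerivQuotient h z = φ z

/-- The Hardy class `H²` of the disk: analytic functions whose square means over the circles
`|z| = r < 1` are bounded. -/
def MemHardyTwo (φ : ℂ → ℂ) : Prop :=
  DifferentiableOn ℂ φ disk ∧
    ∃ C : ℝ, ∀ r : ℝ, 0 ≤ r → r < 1 → Real.circleAverage (fun z => ‖φ z‖ ^ 2) 0 r ≤ C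

/-- The terms `|a_n| r ^ n`, `n ≥ 2`, indexed from zero. -/
noncomputable def majorantTerm (f : ℂ → ℂ) (r : ℝ) (n : ℕ) : ℝ :=
  ‖taylorCoeff f (n + 2)‖ * r ^ (n + 2)

/-- The Euclidean distance from `f 0` to the boundary of the image of the disk. -/
noncomputable def boundaryDist (f : ℂ → ℂ) : ℝ :=
  Metric.infDist (f 0) (frontier (f '' disk))

end MaMinda

/-! Each `f` in the class has the form `z * exp (q z)` with `z q' = φ ∘ ω - 1`, and the extremal
function is `h = z * exp (Q z)` with `z Q' = φ - 1`. Two comparisons of `q` with `Q` carry the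
theorem.

Majorants: for `r ≤ 1/3`, Bohr's inequality shows that composing with `ω` does not increase majorant
sums (`majorantSum_comp_le`). Since the coefficients of `φ` are positive, its majorant series at `r`
is `φ r`. The equation `(exp q)' = q' * exp q` then yields a Grönwall estimate
(`IsMaMinda.majorantSum_exp_le`), so the majorant series of `f` is at most `h r`.

Growth: a minimum argument (`IsMaMinda.re_exponent_ge`) gives `|f z| ≥ -h (-|z|)`, hence the
boundary distance is at least `L = -h(-1)`.

As `h` increases on the real axis, `h r ≤ L` holds exactly up to the root `rf`. For sharpness take
`f = h`: its majorant series is `h r` itself, and `-L` is a boundary point of its image. That `h` is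
univalent is proved by `injOn_mul_exp`. -/

namespace MaMinda

/-! ### Taylor coefficients on the disk. -/

lemma isOpen_disk : IsOpen disk := Metric.isOpen_ball

lemma mem_disk {z : ℂ} : z ∈ disk ↔ ‖z‖ < 1 := by simp [disk]

lemma zero_mem_disk : (0 : ℂ) ∈ disk := by simp [disk]

lemma disk_mem_nhds {z : ℂ} (hz : z ∈ disk) : disk ∈ 𝓝 z := isOpen_disk.mem_nhds hz

lemma analyticAt_of_mem_disk {f : ℂ → ℂ} (hf : DifferentiableOn ℂ f disk) {z : ℂ}
    (hz : z ∈ disk) : AnalyticAt ℂ f z :=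
  hf.analyticAt (disk_mem_nhds hz)

lemma hasDerivAt_of_mem_disk {f : ℂ → ℂ} (hf : DifferentiableOn ℂ f disk) {z : ℂ}
    (hz : z ∈ disk) : HasDerivAt f (deriv f z) z :=
  (hf.differentiableAt (disk_mem_nhds hz)).hasDerivAt

lemma differentiableOn_dslope_disk {f : ℂ → ℂ} (hf : DifferentiableOn ℂ f disk) :
    DifferentiableOn ℂ (dslope f 0) disk :=
  (Complex.differentiableOn_dslope (disk_mem_nhds zero_mem_disk)).2 hf

lemma eq_add_mul_dslope (f : ℂ → ℂ) (z : ℂ) : f z = f 0 + z * dslope f 0 z := by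
  have := sub_smul_dslope f 0 z
  simp only [sub_zero, smul_eq_mul] at this
  rw [this]; ring

lemma hasSum_taylorCoeff {f : ℂ → ℂ} (hf : DifferentiableOn ℂ f disk) {z : ℂ} (hz : z ∈ disk) :
    HasSum (fun n => taylorCoeff f n * z ^ n) (f z) := by
  have := Complex.hasSum_taylorSeries_on_ball hf hz
  refine this.congr_fun ?_
  intro n
  simp only [taylorCoeff, sub_zero, smul_eq_mul]
  ring

lemma taylorCoeff_zero (f : ℂ → ℂ) : taylorCoeff f 0 = f 0 := by simp [taylorCoeff]

lemma taylorCoeff_congr {f g : ℂ → ℂ} (h : f =ᶠ[𝓝 0] g) (n : ℕ) :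
    taylorCoeff f n = taylorCoeff g n := by
  simp only [taylorCoeff, h.iteratedDeriv_eq n]

lemma taylorCoeff_congr_disk {f g : ℂ → ℂ} (h : Set.EqOn f g disk) (n : ℕ) :
    taylorCoeff f n = taylorCoeff g n :=
  taylorCoeff_congr (h.eventuallyEq_of_mem (disk_mem_nhds zero_mem_disk)) n

lemma taylorCoeff_mul {f g : ℂ → ℂ} (hf : AnalyticAt ℂ f 0) (hg : AnalyticAt ℂ g 0) (n : ℕ) :
    taylorCoeff (fun z => f z * g z) n =
      ∑ i ∈ Finset.range (n + 1), taylorCoeff f i * taylorCoeff g (n - i) := by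
  simp only [taylorCoeff]
  rw [iteratedDeriv_fun_mul hf.contDiffAt hg.contDiffAt, Finset.sum_div]
  refine Finset.sum_congr rfl fun i hi => ?_
  have hi' : i ≤ n := Nat.lt_succ_iff.1 (Finset.mem_range.1 hi)
  rw [Nat.cast_choose ℂ hi']
  have h1 : (n.factorial : ℂ) ≠ 0 := by exact_mod_cast n.factorial_ne_zero
  have h2 : (i.factorial : ℂ) ≠ 0 := by exact_mod_cast i.factorial_ne_zero
  have h3 : ((n - i).factorial : ℂ) ≠ 0 := by exact_mod_cast (n - i).factorial_ne_zero
  field_simp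

lemma taylorCoeff_deriv (f : ℂ → ℂ) (n : ℕ) :
    taylorCoeff (deriv f) n = (n + 1) * taylorCoeff f (n + 1) := by
  simp only [taylorCoeff, iteratedDeriv_succ', Nat.factorial_succ]
  have h1 : (n.factorial : ℂ) ≠ 0 := by exact_mod_cast n.factorial_ne_zero
  have h2 : ((n : ℂ) + 1) ≠ 0 := by exact_mod_cast n.succ_ne_zero
  push_cast
  field_simp

lemma taylorCoeff_id (n : ℕ) : taylorCoeff (fun z => z) n = if n = 1 then 1 else 0 := by
  rcases n with _ | _ | n
  · simp [taylorCoeff]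
  · simp [taylorCoeff]
  · rw [taylorCoeff, iteratedDeriv_succ', iteratedDeriv_succ']
    have : deriv (fun z : ℂ => z) = fun _ => 1 := by ext; simp
    rw [this]
    simp

lemma taylorCoeff_id_mul {g : ℂ → ℂ} (hg : AnalyticAt ℂ g 0) (n : ℕ) :
    taylorCoeff (fun z => z * g z) (n + 1) = taylorCoeff g n := by
  rw [taylorCoeff_mul (f := fun z => z) analyticAt_id hg, Finset.sum_eq_single 1]
  · have := taylorCoeff_id 1
    simp [this]
  · intro b _ hb
    have := taylorCoeff_id b
    simp [this, hb]
  · simp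

lemma taylorCoeff_const_add_succ (c : ℂ) (g : ℂ → ℂ) (n : ℕ) :
    taylorCoeff (fun z => c + g z) (n + 1) = taylorCoeff g (n + 1) := by
  rw [taylorCoeff, taylorCoeff, iteratedDeriv_succ', iteratedDeriv_succ']
  congr 2
  ext z
  exact deriv_const_add c

lemma taylorCoeff_dslope {f : ℂ → ℂ} (hf : DifferentiableOn ℂ f disk) (n : ℕ) :
    taylorCoeff (dslope f 0) n = taylorCoeff f (n + 1) := by
  conv_rhs => rw [show f = fun z => f 0 + z * dslope f 0 z from funext (eq_add_mul_dslope f)]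
  rw [taylorCoeff_const_add_succ, taylorCoeff_id_mul]
  exact analyticAt_of_mem_disk (differentiableOn_dslope_disk hf) zero_mem_disk

/-! ### Coefficient bounds for bounded functions. -/

lemma circleAverage_inv_pow_mul {f : ℂ → ℂ} (hf : DifferentiableOn ℂ f disk) {ρ : ℝ} (h0 : 0 < ρ)
    (h1 : ρ < 1) (n : ℕ) :
    Real.circleAverage (fun z => (z ^ n)⁻¹ * f z) 0 ρ = taylorCoeff f n := by
  have hsub : Metric.closedBall (0 : ℂ) ρ ⊆ disk := Metric.closedBall_subset_ball h1
  have hd : DiffContOnCl ℂ f (Metric.ball 0 ρ) :=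
    DifferentiableOn.diffContOnCl (hf.mono (by rwa [closure_ball _ h0.ne']))
  have := hd.circleIntegral_one_div_sub_center_pow_smul h0 n
  rw [Real.circleAverage_eq_circleIntegral h0.ne']
  have h2 : (∮ z in C(0, ρ), (z - 0)⁻¹ • ((z ^ n)⁻¹ * f z)) =
      ∮ z in C(0, ρ), (1 / (z - 0) ^ (n + 1)) • f z := by
    congr 1
    ext z
    simp only [sub_zero, smul_eq_mul, one_div, pow_succ, mul_inv]
    ring
  rw [h2, this, taylorCoeff]
  have hpi : (2 * (Real.pi : ℂ) * Complex.I) ≠ 0 := Complex.two_pi_I_ne_zero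
  simp only [smul_eq_mul]
  field_simp

lemma circleAverage_pow_mul {f : ℂ → ℂ} (hf : DifferentiableOn ℂ f disk) {ρ : ℝ} (h0 : 0 < ρ)
    (h1 : ρ < 1) {n : ℕ} (hn : n ≠ 0) :
    Real.circleAverage (fun z => z ^ n * f z) 0 ρ = 0 := by
  have hsub : Metric.closedBall (0 : ℂ) ρ ⊆ disk := Metric.closedBall_subset_ball h1
  have hd : DiffContOnCl ℂ (fun z => z ^ n * f z) (Metric.ball 0 |ρ|) := by
    refine DifferentiableOn.diffContOnCl ?_
    rw [abs_of_pos h0, closure_ball _ h0.ne']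
    exact (differentiable_id.pow n).differentiableOn.mul (hf.mono hsub)
  rw [hd.circleAverage]
  simp [hn]

/-- On `|z| = ρ` one has `conj z = ρ² / z`, so the kernel is a combination of `1`, `z ^ n` and `z ^
(-n)`; these contribute `f 0`, nothing, and the `n`-th coefficient. Dividing by `ρ ^ n` makes the
kernel nonnegative when `|v| = 1`. -/
lemma circleAverage_kernel_mul {f : ℂ → ℂ} (hf : DifferentiableOn ℂ f disk)
    {n : ℕ} (hn : n ≠ 0) (v : ℂ) {ρ : ℝ} (h0 : 0 < ρ) (h1 : ρ < 1) :
    Real.circleAverage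
      (fun z => (((1 + ((starRingEnd ℂ) v / ρ ^ n * z ^ n).re : ℝ)) : ℂ) * f z) 0 ρ =
      f 0 + v * ρ ^ n / 2 * taylorCoeff f n := by
  have hρ : (ρ : ℂ) ≠ 0 := by exact_mod_cast h0.ne'
  set u : ℂ := (starRingEnd ℂ) v / ρ ^ n with hu
  have hsph : Metric.sphere (0 : ℂ) ρ ⊆ disk :=
    Metric.sphere_subset_closedBall.trans (Metric.closedBall_subset_ball h1)
  have hker : ∀ z ∈ Metric.sphere (0 : ℂ) |ρ|,
      (((1 + (u * z ^ n).re : ℝ)) : ℂ) * f z =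
        (f z + (u / 2) • (z ^ n * f z)) + (v * ρ ^ n / 2) • ((z ^ n)⁻¹ * f z) := by
    intro z hz
    have hz' : ‖z‖ = ρ := by simpa [abs_of_pos h0] using hz
    have hz0 : z ≠ 0 := by rintro rfl; simp at hz'; exact h0.ne hz'
    have hzz : (starRingEnd ℂ) z = ρ ^ 2 / z := by
      rw [eq_div_iff hz0, mul_comm, Complex.mul_conj, Complex.normSq_eq_norm_sq, hz']; simp
    have hre : (((u * z ^ n).re : ℝ) : ℂ) = (u * z ^ n + v * ρ ^ n * (z ^ n)⁻¹) / 2 := by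
      rw [Complex.re_eq_add_conj, map_mul, map_pow, hzz, hu, map_div₀, map_pow, Complex.conj_ofReal,
        Complex.conj_conj, div_pow]
      field_simp
      ring
    push_cast
    rw [hre]
    simp only [smul_eq_mul]
    ring
  have hc : ContinuousOn f (Metric.sphere 0 ρ) := hf.continuousOn.mono hsph
  have hcp : ContinuousOn (fun z => (u / 2) • (z ^ n * f z)) (Metric.sphere 0 ρ) :=
    ((continuous_pow n).continuousOn.mul hc).const_smul (u / 2)
  have hne : ∀ z ∈ Metric.sphere (0 : ℂ) ρ, z ^ n ≠ 0 := by
    intro z hz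
    refine pow_ne_zero _ ?_
    rintro rfl
    simp at hz
    exact h0.ne hz
  have hcm : ContinuousOn (fun z => (v * ρ ^ n / 2) • ((z ^ n)⁻¹ * f z)) (Metric.sphere 0 ρ) :=
    (((continuous_pow n).continuousOn.inv₀ hne).mul hc).const_smul (v * ρ ^ n / 2)
  have h00 := circleAverage_inv_pow_mul hf h0 h1 0
  simp only [pow_zero, inv_one, one_mul, taylorCoeff_zero] at h00
  rw [Real.circleAverage_congr_sphere hker,
    Real.circleAverage_fun_add (f₁ := fun z => f z + (u / 2) • (z ^ n * f z))
      (f₂ := fun z => (v * ρ ^ n / 2) • ((z ^ n)⁻¹ * f z))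
      (ContinuousOn.circleIntegrable h0.le (hc.add hcp)) (hcm.circleIntegrable h0.le),
    Real.circleAverage_fun_add (hc.circleIntegrable h0.le) (hcp.circleIntegrable h0.le),
    Real.circleAverage_fun_smul, Real.circleAverage_fun_smul, circleAverage_pow_mul hf h0 h1 hn,
    circleAverage_inv_pow_mul hf h0 h1, h00]
  simp

/-- Testing a bounded analytic function against the nonnegative kernel `1 + Re (u zⁿ)`. -/
lemma norm_add_half_mul_le {f : ℂ → ℂ} (hf : DifferentiableOn ℂ f disk)
    (hb : ∀ z ∈ disk, ‖f z‖ ≤ 1) {n : ℕ} (hn : n ≠ 0) (v : ℂ) (hv : ‖v‖ = 1) {ρ : ℝ} (h0 : 0 < ρ)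
    (h1 : ρ < 1) : ‖f 0 + v * ρ ^ n / 2 * taylorCoeff f n‖ ≤ 1 := by
  -- The case of the constant function `1` says that the kernel has mean one; being nonnegative, it
  -- averages `f` to a value of norm at most one.
  have hone := circleAverage_kernel_mul (f := fun _ => (1 : ℂ)) (differentiableOn_const _) hn v
    h0 h1
  have hcoeff : taylorCoeff (fun _ => (1 : ℂ)) n = 0 := by
    simp [taylorCoeff, iteratedDeriv_const, hn]
  rw [hcoeff] at hone
  rw [← circleAverage_kernel_mul hf hn v h0 h1]
  set K : ℂ → ℝ := fun z => 1 + ((starRingEnd ℂ) v / ρ ^ n * z ^ n).re with hK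
  have hone' : (2 * Real.pi)⁻¹ * ∫ θ in 0..2 * Real.pi, K (circleMap 0 ρ θ) = 1 := by
    have h2 : Real.circleAverage (fun z => ((K z : ℝ) : ℂ)) 0 ρ = 1 := by
      simpa only [mul_one, mul_zero, add_zero] using hone
    rw [Real.circleAverage_def, intervalIntegral.integral_ofReal, Complex.real_smul] at h2
    exact_mod_cast h2
  have hKc : Continuous fun θ : ℝ => K (circleMap 0 ρ θ) := by
    simp only [hK]
    fun_prop
  refine le_trans ?_ hone'.le
  rw [Real.circleAverage_def, norm_smul, Real.norm_of_nonneg (by positivity)]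
  refine mul_le_mul_of_nonneg_left ?_ (by positivity)
  refine intervalIntegral.norm_integral_le_of_norm_le (by positivity) ?_
    (hKc.intervalIntegrable _ _)
  refine Filter.Eventually.of_forall fun θ _ => ?_
  have hθ : ‖circleMap 0 ρ θ‖ = ρ := by simp [abs_of_pos h0]
  have hKn : 0 ≤ K (circleMap 0 ρ θ) := by
    have h3 : ‖(starRingEnd ℂ) v / ρ ^ n * circleMap 0 ρ θ ^ n‖ = 1 := by
      rw [norm_mul, norm_div, norm_pow, norm_pow, hθ, RCLike.norm_conj, hv, Complex.norm_real,
        Real.norm_of_nonneg h0.le, one_div, inv_mul_cancel₀ (pow_ne_zero _ h0.ne')]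
    have := (abs_le.1 (Complex.abs_re_le_norm ((starRingEnd ℂ) v / ρ ^ n * circleMap 0 ρ θ ^ n))).1
    simp only [hK]
    linarith
  change ‖((K (circleMap 0 ρ θ) : ℝ) : ℂ) * f (circleMap 0 ρ θ)‖ ≤ _
  rw [norm_mul, Complex.norm_real, Real.norm_of_nonneg hKn]
  exact mul_le_of_le_one_right hKn (hb _ (mem_disk.2 (by rw [hθ]; exact h1)))

lemma exists_norm_one_norm_add_mul (a b : ℂ) : ∃ v : ℂ, ‖v‖ = 1 ∧ ‖a + v * b‖ = ‖a‖ + ‖b‖ := by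
  by_cases ha : a = 0
  · exact ⟨1, by simp, by simp [ha]⟩
  by_cases hb : b = 0
  · exact ⟨1, by simp, by simp [hb]⟩
  have ha' : (‖a‖ : ℂ) ≠ 0 := by simpa using ha
  refine ⟨a / ‖a‖ * (‖b‖ / b), by simp [ha, hb], ?_⟩
  have : a + a / ‖a‖ * (‖b‖ / b) * b = a / ‖a‖ * ((‖a‖ + ‖b‖ : ℝ) : ℂ) := by
    push_cast
    field_simp
  rw [this, norm_mul, Complex.norm_real, Real.norm_of_nonneg (by positivity)]
  simp [ha]

/-- A Carathéodory type coefficient bound for analytic functions bounded by one. -/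
lemma norm_taylorCoeff_le {f : ℂ → ℂ} (hf : DifferentiableOn ℂ f disk)
    (hb : ∀ z ∈ disk, ‖f z‖ ≤ 1) {n : ℕ} (hn : n ≠ 0) :
    ‖taylorCoeff f n‖ ≤ 2 * (1 - ‖f 0‖) := by
  -- This `v` aligns the phases, so letting `ρ → 1` in the kernel bound gives `|f 0| + |a_n| / 2 ≤
  -- 1`.
  obtain ⟨v, hv, hvn⟩ := exists_norm_one_norm_add_mul (f 0) (taylorCoeff f n / 2)
  have hlim : Tendsto (fun ρ : ℝ => ‖f 0 + v * ρ ^ n / 2 * taylorCoeff f n‖) (𝓝[<] 1)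
      (𝓝 ‖f 0 + v * ((1 : ℝ) : ℂ) ^ n / 2 * taylorCoeff f n‖) := by
    refine Tendsto.mono_left ?_ nhdsWithin_le_nhds
    refine Continuous.tendsto (f := fun ρ : ℝ => ‖f 0 + v * ρ ^ n / 2 * taylorCoeff f n‖) ?_ 1
    fun_prop
  have hle : ‖f 0 + v * ((1 : ℝ) : ℂ) ^ n / 2 * taylorCoeff f n‖ ≤ 1 := by
    refine le_of_tendsto hlim ?_
    filter_upwards [Ioo_mem_nhdsLT (zero_lt_one (α := ℝ))] with ρ hρ
    exact norm_add_half_mul_le hf hb hn v hv hρ.1 hρ.2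
  have : f 0 + v * ((1 : ℝ) : ℂ) ^ n / 2 * taylorCoeff f n = f 0 + v * (taylorCoeff f n / 2) := by
    simp; ring
  rw [this, hvn, norm_div] at hle
  norm_num at hle
  linarith

/-! ### Majorant sums, Bohr's inequality and subordination. -/

/-- The partial sums of the majorant series of `f`. -/
noncomputable def majorantSum (f : ℂ → ℂ) (r : ℝ) (N : ℕ) : ℝ :=
  ∑ k ∈ Finset.range (N + 1), ‖taylorCoeff f k‖ * r ^ k

lemma majorantSum_zero (f : ℂ → ℂ) (r : ℝ) : majorantSum f r 0 = ‖f 0‖ := by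
  simp [majorantSum, taylorCoeff_zero]

lemma majorantSum_nonneg (f : ℂ → ℂ) {r : ℝ} (hr : 0 ≤ r) (N : ℕ) : 0 ≤ majorantSum f r N :=
  Finset.sum_nonneg fun _ _ => by positivity

lemma majorantSum_succ' (f : ℂ → ℂ) (r : ℝ) (N : ℕ) : majorantSum f r (N + 1) =
    ‖f 0‖ + r * ∑ k ∈ Finset.range (N + 1), ‖taylorCoeff f (k + 1)‖ * r ^ k := by
  rw [majorantSum, Finset.sum_range_succ', Finset.mul_sum, add_comm]
  simp only [taylorCoeff_zero, pow_zero, mul_one, pow_succ]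
  congr 1
  exact Finset.sum_congr rfl fun _ _ => by ring

/-- The truncated Cauchy product sums over a triangle contained in the square on the right. -/
lemma sum_range_sum_mul_le {a b : ℕ → ℝ} (ha : ∀ n, 0 ≤ a n) (hb : ∀ n, 0 ≤ b n) (N : ℕ) :
    ∑ n ∈ Finset.range (N + 1), ∑ i ∈ Finset.range (n + 1), a i * b (n - i) ≤
      (∑ n ∈ Finset.range (N + 1), a n) * ∑ n ∈ Finset.range (N + 1), b n := by
  rw [Finset.sum_range_diag_flip (N + 1) fun i j => a i * b j, Finset.sum_mul_sum]
  refine Finset.sum_le_sum fun i _ => ?_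
  refine Finset.sum_le_sum_of_subset_of_nonneg ?_ fun j _ _ => mul_nonneg (ha i) (hb j)
  exact Finset.range_mono (Nat.sub_le _ _)

lemma majorantSum_mul_le {f g : ℂ → ℂ} (hf : AnalyticAt ℂ f 0) (hg : AnalyticAt ℂ g 0) {r : ℝ}
    (hr : 0 ≤ r) (N : ℕ) :
    majorantSum (fun z => f z * g z) r N ≤ majorantSum f r N * majorantSum g r N := by
  refine le_trans ?_ (sum_range_sum_mul_le (fun n => by positivity) (fun n => by positivity) N)
  refine Finset.sum_le_sum fun n _ => ?_
  rw [taylorCoeff_mul hf hg]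
  refine (mul_le_mul_of_nonneg_right (norm_sum_le _ _) (by positivity)).trans (le_of_eq ?_)
  rw [Finset.sum_mul]
  refine Finset.sum_congr rfl fun i hi => ?_
  rw [norm_mul, ← Nat.add_sub_of_le (Nat.lt_succ_iff.1 (Finset.mem_range.1 hi)), pow_add]
  simp only [Nat.add_sub_cancel_left]
  ring

/-- **Bohr's inequality**, for partial sums. -/
lemma majorantSum_le_one {f : ℂ → ℂ} (hf : DifferentiableOn ℂ f disk)
    (hb : ∀ z ∈ disk, ‖f z‖ ≤ 1) {r : ℝ} (hr : 0 ≤ r) (hr3 : r ≤ 1 / 3) (N : ℕ) :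
    majorantSum f r N ≤ 1 := by
  have h0 := hb 0 zero_mem_disk
  rcases N with _ | N
  · rwa [majorantSum_zero]
  rw [majorantSum_succ']
  have h1 : ∑ k ∈ Finset.range (N + 1), ‖taylorCoeff f (k + 1)‖ * r ^ k ≤
      2 * (1 - ‖f 0‖) * ∑ k ∈ Finset.range (N + 1), r ^ k := by
    rw [Finset.mul_sum]
    exact Finset.sum_le_sum fun k _ =>
      mul_le_mul_of_nonneg_right (norm_taylorCoeff_le hf hb k.succ_ne_zero) (by positivity)
  -- The radius `1/3` enters here: `r / (1 - r) ≤ 1/2` compensates the factor `2` in the coefficient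
  -- bound.
  have h2 : r * ∑ k ∈ Finset.range (N + 1), r ^ k ≤ 1 / 2 := by
    have h3 : ∑ k ∈ Finset.range (N + 1), r ^ k ≤ (1 - r)⁻¹ := by
      rw [← tsum_geometric_of_lt_one hr (by linarith)]
      exact (summable_geometric_of_lt_one hr (by linarith)).sum_le_tsum _
        fun _ _ => by positivity
    refine (mul_le_mul_of_nonneg_left h3 hr).trans ?_
    rw [← div_eq_mul_inv, div_le_iff₀ (by linarith)]
    linarith
  have h4 := mul_le_mul_of_nonneg_left h1 hr
  have h5 := mul_le_mul_of_nonneg_left h2 (by linarith : 0 ≤ 2 * (1 - ‖f 0‖))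
  nlinarith

/-- Subordination decreases majorant partial sums up to the radius `1 / 3`. -/
lemma majorantSum_comp_le {ω : ℂ → ℂ} (hω : DifferentiableOn ℂ ω disk)
    (hmaps : Set.MapsTo ω disk disk) (hω0 : ω 0 = 0) {r : ℝ} (hr : 0 ≤ r) (hr3 : r ≤ 1 / 3)
    (N : ℕ) : ∀ g : ℂ → ℂ, DifferentiableOn ℂ g disk →
      majorantSum (fun z => g (ω z)) r N ≤ majorantSum g r N := by
  have hψ := differentiableOn_dslope_disk hω
  have hψb : ∀ z ∈ disk, ‖dslope ω 0 z‖ ≤ 1 := by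
    intro z hz
    have := Complex.norm_dslope_le_div_of_mapsTo_ball (R₁ := 1) (R₂ := 1) hω
      (by rw [hω0]; exact hmaps.mono_right Metric.ball_subset_closedBall) hz
    simpa using this
  -- Write `ω = z ψ` and `g w = g 0 + w k(w)`, so that `g ∘ ω = g 0 + z ψ (k ∘ ω)`. Schwarz's lemma
  -- gives `|ψ| ≤ 1`, Bohr's inequality removes `ψ`, and the induction hypothesis is applied to `k`;
  -- hence `g` must remain arbitrary.
  induction N with
  | zero => intro g _; simp [majorantSum_zero, hω0]
  | succ N ih =>
    intro g hg
    have hk := differentiableOn_dslope_disk hg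
    have hS : DifferentiableOn ℂ (fun z => dslope g 0 (ω z)) disk := hk.comp hω hmaps
    have hψa := analyticAt_of_mem_disk hψ zero_mem_disk
    have hSa := analyticAt_of_mem_disk hS zero_mem_disk
    have hfun : (fun z => g (ω z)) =
        fun z => g 0 + z * (dslope ω 0 z * dslope g 0 (ω z)) := by
      ext z
      rw [eq_add_mul_dslope g (ω z)]
      conv_lhs => rw [show g 0 + ω z * dslope g 0 (ω z) =
        g 0 + (ω 0 + z * dslope ω 0 z) * dslope g 0 (ω z) by rw [← eq_add_mul_dslope ω z]]
      rw [hω0]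
      ring
    have hcoeff : ∀ k, taylorCoeff (fun z => g (ω z)) (k + 1) =
        taylorCoeff (fun z => dslope ω 0 z * dslope g 0 (ω z)) k := by
      intro k
      rw [hfun, taylorCoeff_const_add_succ]
      exact taylorCoeff_id_mul (hψa.mul hSa) k
    rw [majorantSum_succ', majorantSum_succ', hω0]
    simp only [hcoeff, ← taylorCoeff_dslope hg]
    have h1 : majorantSum (fun z => dslope ω 0 z * dslope g 0 (ω z)) r N ≤
        majorantSum (dslope g 0) r N := by
      refine (majorantSum_mul_le hψa hSa hr N).trans ?_
      refine (mul_le_of_le_one_left (majorantSum_nonneg _ hr N)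
        (majorantSum_le_one hψ hψb hr hr3 N)).trans (ih _ hk)
    exact add_le_add_right (mul_le_mul_of_nonneg_left h1 hr) _

end MaMinda

/-! ### Exponential representation and univalence. -/

namespace MaMinda

/-- The quotient `(p z - 1) / z` extends analytically as `dslope p 0`, and has a primitive on the
disk. -/
lemma exists_exponent {p : ℂ → ℂ} (hp : DifferentiableOn ℂ p disk) (hp0 : p 0 = 1) :
    ∃ q : ℂ → ℂ, DifferentiableOn ℂ q disk ∧ q 0 = 0 ∧
      ∀ z ∈ disk, z * deriv q z = p z - 1 := by
  obtain ⟨q, hq0, hq⟩ :=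
    ((differentiableOn_dslope_disk hp).isExactOn_ball (c := 0) (r := 1)).with_val_at 0 0
  refine ⟨q, fun z hz => (hq z hz).differentiableAt.differentiableWithinAt, hq0, fun z hz => ?_⟩
  rw [(hq z hz).deriv, eq_add_mul_dslope p z, hp0]
  ring

lemma hasDerivAt_mul_exp {q : ℂ → ℂ} (hq : DifferentiableOn ℂ q disk) {z : ℂ} (hz : z ∈ disk) :
    HasDerivAt (fun z => z * Complex.exp (q z)) (Complex.exp (q z) * (1 + z * deriv q z)) z := by
  have := (hasDerivAt_id z).mul (hasDerivAt_of_mem_disk hq hz).cexp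
  convert! this using 1
  simp only [id]
  ring

/-- With `f = z g` the equation becomes `z² (g' - q' g) = 0`. Thus `g' = q' g` off the origin, and
at the origin by continuity, so `g * exp (-q)` is constant. -/
lemma eq_mul_exp {f p q : ℂ → ℂ} (hf : DifferentiableOn ℂ f disk) (hf0 : f 0 = 0)
    (hf1 : deriv f 0 = 1) (hfp : ∀ z ∈ disk, z * deriv f z = p z * f z)
    (hq : DifferentiableOn ℂ q disk) (hq0 : q 0 = 0)
    (hqp : ∀ z ∈ disk, z * deriv q z = p z - 1) :
    ∀ z ∈ disk, f z = z * Complex.exp (q z) := by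
  set g := dslope f 0 with hgdef
  have hg : DifferentiableOn ℂ g disk := differentiableOn_dslope_disk hf
  have hfg : ∀ z, f z = z * g z := fun z => by rw [eq_add_mul_dslope f z, hf0, zero_add]
  have hg0 : g 0 = 1 := by rw [hgdef, dslope_same, hf1]
  have hne : ∀ z ∈ disk, z ≠ 0 → deriv g z = deriv q z * g z := by
    intro z hz hz0
    have h1 : deriv f z = g z + z * deriv g z := by
      have := (hasDerivAt_id z).mul (hasDerivAt_of_mem_disk hg hz)
      have h2 : HasDerivAt f (1 * g z + id z * deriv g z) z :=
        this.congr_of_eventuallyEq (Eventually.of_forall hfg)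
      rw [h2.deriv]; simp
    have h3 := hfp z hz
    rw [h1, hfg] at h3
    have h4 := hqp z hz
    have h5 : z ^ 2 * (deriv g z - deriv q z * g z) = 0 := by
      linear_combination h3 - z * g z * h4
    rcases mul_eq_zero.1 h5 with h | h
    · exact absurd (pow_eq_zero_iff (two_ne_zero)|>.1 h) hz0
    · exact sub_eq_zero.1 h
  have hcont : ∀ {u : ℂ → ℂ}, DifferentiableOn ℂ u disk → ContinuousAt u 0 := fun hu =>
    (hu.differentiableAt (disk_mem_nhds zero_mem_disk)).continuousAt
  have hgd : DifferentiableOn ℂ (deriv g) disk := hg.deriv isOpen_disk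
  have hqd : DifferentiableOn ℂ (deriv q) disk := hq.deriv isOpen_disk
  have hall : ∀ z ∈ disk, deriv g z = deriv q z * g z := by
    intro z hz
    by_cases hz0 : z = 0
    · subst hz0
      refine tendsto_nhds_unique (l := 𝓝[≠] (0 : ℂ)) ((hcont hgd).tendsto.mono_left
        nhdsWithin_le_nhds) ?_
      refine (((hcont hqd).mul (hcont hg)).tendsto.mono_left nhdsWithin_le_nhds).congr' ?_
      filter_upwards [self_mem_nhdsWithin, nhdsWithin_le_nhds (disk_mem_nhds zero_mem_disk)]
        with w hw0 hw
      exact (hne w hw hw0).symm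
    · exact hne z hz hz0
  have hy : ∀ z ∈ disk, HasDerivAt (fun z => g z * Complex.exp (-q z)) 0 z := by
    intro z hz
    have := (hasDerivAt_of_mem_disk hg hz).mul (hasDerivAt_of_mem_disk hq hz).neg.cexp
    convert! this using 1
    rw [hall z hz]; simp only [Pi.neg_apply]; ring
  have hconst : ∀ z ∈ disk, g z * Complex.exp (-q z) = 1 := by
    intro z hz
    have h1 := isOpen_disk.is_const_of_deriv_eq_zero (Metric.isPreconnected_ball)
      (fun w hw => (hy w hw).differentiableAt.differentiableWithinAt)
      (fun w hw => (hy w hw).deriv) hz zero_mem_disk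
    simpa [hg0, hq0] using h1
  intro z hz
  rw [hfg z, ← one_mul (Complex.exp _), ← hconst z hz, mul_assoc, ← Complex.exp_add]
  simp

lemma IsClassS.ne_zero {f : ℂ → ℂ} (hf : IsClassS f) {z : ℂ} (hz : z ∈ disk) (h0 : z ≠ 0) :
    f z ≠ 0 := fun h => h0 (hf.univalent hz zero_mem_disk (by rw [h, hf.map_zero]))

lemma IsClassS.mul_deriv_eq {f : ℂ → ℂ} (hf : IsClassS f) {p : ℂ → ℂ}
    (hp : ∀ z ∈ disk, logDerivQuotient f z = p z) :
    ∀ z ∈ disk, z * deriv f z = p z * f z := by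
  intro z hz
  by_cases h0 : z = 0
  · simp [h0, hf.map_zero]
  · rw [← hp z hz, logDerivQuotient, if_neg h0, div_mul_cancel₀ _ (hf.ne_zero hz h0)]

/-- Near a nonzero point, one can move inwards along the preimage of a radial segment. -/
lemma exists_inward_path {q : ℂ → ℂ} (hq : DifferentiableOn ℂ q disk) {a : ℂ} (ha : a ∈ disk)
    (ha0 : a ≠ 0) (hre : 0 < (1 + a * deriv q a).re) :
    ∃ g : ℝ → ℂ, Tendsto g (𝓝[>] 0) (𝓝 a) ∧ ∀ᶠ t : ℝ in 𝓝[>] 0,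
      g t * Complex.exp (q (g t)) = (1 - t) * (a * Complex.exp (q a)) ∧ ‖g t‖ < ‖a‖ := by
  set f : ℂ → ℂ := fun z => z * Complex.exp (q z) with hfdef
  set P : ℂ := 1 + a * deriv q a with hP
  have hP0 : P ≠ 0 := by intro h; rw [h] at hre; simp at hre
  have hfa : AnalyticAt ℂ f a := analyticAt_id.mul (analyticAt_of_mem_disk hq ha).cexp
  have hne : Complex.exp (q a) * P ≠ 0 := mul_ne_zero (Complex.exp_ne_zero _) hP0
  have hst : HasStrictDerivAt f (Complex.exp (q a) * P) a := by
    have := hfa.hasStrictDerivAt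
    rwa [(hasDerivAt_mul_exp hq ha).deriv] at this
  set G := hst.localInverse f _ a hne with hG
  have hGd : HasStrictDerivAt G (Complex.exp (q a) * P)⁻¹ (f a) := hst.to_localInverse hne
  have hGa : G (f a) = a :=
    HasStrictFDerivAt.localInverse_apply_image (hst.hasStrictFDerivAt_equiv hne)
  have hGr : ∀ᶠ w in 𝓝 (f a), f (G w) = w :=
    HasStrictFDerivAt.eventually_right_inverse (hst.hasStrictFDerivAt_equiv hne)
  have hline : HasDerivAt (fun t : ℝ => (1 - (t : ℂ)) * f a) (-f a) 0 := by
    have h1 : HasDerivAt (fun t : ℝ => (t : ℂ)) 1 0 := Complex.ofRealCLM.hasDerivAt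
    simpa using (h1.const_sub 1).mul_const (f a)
  have hline0 : (1 - ((0 : ℝ) : ℂ)) * f a = f a := by simp
  have hgd : HasDerivAt (fun t : ℝ => G ((1 - (t : ℂ)) * f a)) (-a / P) 0 := by
    have h2 : HasDerivAt G (Complex.exp (q a) * P)⁻¹ ((1 - ((0 : ℝ) : ℂ)) * f a) := by
      rw [hline0]; exact hGd.hasDerivAt
    have := h2.comp (0 : ℝ) hline
    convert! this using 1
    simp only [hfdef]
    have := Complex.exp_ne_zero (q a)
    field_simp
  have hg0 : G ((1 - ((0 : ℝ) : ℂ)) * f a) = a := by rw [hline0, hGa]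
  refine ⟨fun t : ℝ => G ((1 - (t : ℂ)) * f a), ?_, ?_⟩
  · have := hgd.continuousAt.tendsto
    simp only [hg0] at this
    exact this.mono_left nhdsWithin_le_nhds
  · have hc : Tendsto (fun t : ℝ => (1 - (t : ℂ)) * f a) (𝓝[>] 0) (𝓝 (f a)) := by
      have := hline.continuousAt.tendsto
      rw [hline0] at this
      exact this.mono_left nhdsWithin_le_nhds
    have hsq := hgd.norm_sq
    -- The path has velocity `-a / P` at `0`, so `|g|²` has derivative `-2 |a|² Re (1 / P)`,
    -- negative because `Re P > 0`.
    have hneg : 2 * inner ℝ (G ((1 - ((0 : ℝ) : ℂ)) * f a)) (-a / P) < 0 := by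
      rw [hg0, Complex.inner]
      have h3 : -a / P * (starRingEnd ℂ) a = ((-(Complex.normSq a) : ℝ) : ℂ) * P⁻¹ := by
        push_cast
        rw [← Complex.mul_conj]
        ring
      have h4 : 0 < Complex.normSq a := Complex.normSq_pos.2 ha0
      have h5 : 0 < (P⁻¹).re := by
        rw [Complex.inv_re]
        exact div_pos hre (Complex.normSq_pos.2 hP0)
      rw [h3, Complex.re_ofReal_mul]
      nlinarith [mul_pos h4 h5]
    have hslope := hsq.tendsto_slope_zero_right
    filter_upwards [hc.eventually hGr, hslope.eventually_lt_const hneg, self_mem_nhdsWithin]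
      with t ht1 ht2 ht3
    refine ⟨ht1, ?_⟩
    have ht3' : (0 : ℝ) < t := ht3
    simp only [zero_add, hg0, smul_eq_mul] at ht2
    have h6 : ‖G ((1 - (t : ℂ)) * f a)‖ ^ 2 < ‖a‖ ^ 2 := by
      by_contra hcon
      have : 0 ≤ t⁻¹ * (‖G ((1 - (t : ℂ)) * f a)‖ ^ 2 - ‖a‖ ^ 2) :=
        mul_nonneg (by positivity) (by linarith)
      linarith
    exact lt_of_pow_lt_pow_left₀ 2 (norm_nonneg _) h6

/-- Normalized starlike functions are univalent. -/
lemma injOn_mul_exp {q : ℂ → ℂ} (hq : DifferentiableOn ℂ q disk)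
    (hre : ∀ z ∈ disk, 0 < (1 + z * deriv q z).re) :
    Set.InjOn (fun z => z * Complex.exp (q z)) disk := by
  set f : ℂ → ℂ := fun z => z * Complex.exp (q z) with hfdef
  have hf : DifferentiableOn ℂ f disk := differentiableOn_id.mul hq.cexp
  intro z₁ hz₁ z₂ hz₂ heq
  by_contra hne
  set R := max ‖z₁‖ ‖z₂‖ with hR
  have hR1 : R < 1 := max_lt (mem_disk.1 hz₁) (mem_disk.1 hz₂)
  have hsub : Metric.closedBall (0 : ℂ) R ⊆ disk := Metric.closedBall_subset_ball hR1
  set B : Set (ℂ × ℂ) := Metric.closedBall (0 : ℂ) R ×ˢ Metric.closedBall (0 : ℂ) R with hB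
  have hBc : IsCompact B := (isCompact_closedBall _ _).prod (isCompact_closedBall _ _)
  -- `E` consists of the collisions outside an open set `W` in which every collision is diagonal.
  -- Removing `W`, rather than the diagonal alone, keeps `E` compact. A minimizer of `|a| + |b|` on
  -- `E` is off the diagonal because `f' ≠ 0`, and moving both points inward along the preimages of
  -- one radial segment contradicts minimality.
  set W : Set (ℂ × ℂ) := interior {p | f p.1 = f p.2 → p.1 = p.2} with hW
  set E : Set (ℂ × ℂ) := {p ∈ B | f p.1 - f p.2 = 0} ∩ Wᶜ with hE
  have hcont : ContinuousOn (fun p : ℂ × ℂ => f p.1 - f p.2) B :=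
    ((hf.continuousOn.mono hsub).comp continuousOn_fst fun p hp => hp.1).sub
      ((hf.continuousOn.mono hsub).comp continuousOn_snd fun p hp => hp.2)
  have hEc : IsCompact E := by
    have h1 : IsClosed {p ∈ B | f p.1 - f p.2 = 0} :=
      hcont.preimage_isClosed_of_isClosed hBc.isClosed isClosed_singleton
    exact (hBc.of_isClosed_subset h1 (fun p hp => hp.1)).inter_right isOpen_interior.isClosed_compl
  have hEne : E.Nonempty := by
    refine ⟨(z₁, z₂), ⟨⟨?_, ?_⟩, sub_eq_zero.2 heq⟩, fun h => hne (interior_subset h heq)⟩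
    · simp [hR]
    · simp [hR]
  obtain ⟨⟨a, b⟩, hab, hmin⟩ := hEc.exists_isMinOn hEne
    (f := fun p : ℂ × ℂ => ‖p.1‖ + ‖p.2‖) (by fun_prop)
  have haB : a ∈ Metric.closedBall (0 : ℂ) R := hab.1.1.1
  have hbB : b ∈ Metric.closedBall (0 : ℂ) R := hab.1.1.2
  have hfab : f a = f b := sub_eq_zero.1 hab.1.2
  have hderiv : ∀ z ∈ disk, HasStrictDerivAt f (Complex.exp (q z) * (1 + z * deriv q z)) z := by
    intro z hz
    have := (analyticAt_of_mem_disk hf hz).hasStrictDerivAt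
    rwa [(hasDerivAt_mul_exp hq hz).deriv] at this
  have hdne : ∀ z ∈ disk, Complex.exp (q z) * (1 + z * deriv q z) ≠ 0 := by
    intro z hz
    refine mul_ne_zero (Complex.exp_ne_zero _) fun h => ?_
    have := hre z hz
    rw [h] at this
    simp at this
  have hab_ne : a ≠ b := by
    rintro rfl
    refine hab.2 ?_
    rw [hW, mem_interior_iff_mem_nhds]
    have h2 := (hderiv a (hsub haB)).hasStrictFDerivAt_equiv (hdne a (hsub haB))
    obtain ⟨s, hs, hinj⟩ : ∃ s ∈ 𝓝 a, Set.InjOn f s := by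
      refine ⟨_, h2.toOpenPartialHomeomorph f |>.open_source.mem_nhds
        (h2.mem_toOpenPartialHomeomorph_source), ?_⟩
      exact (h2.toOpenPartialHomeomorph f).injOn
    filter_upwards [prod_mem_nhds hs hs] with p hp hpe
    exact hinj hp.1 hp.2 hpe
  have hzero : ∀ z, f z = 0 → z = 0 := fun z hz => by simpa [hfdef] using hz
  have hb0 : b ≠ 0 := fun h => hab_ne <| by
    rw [h] at hfab ⊢
    exact hzero a (by rw [hfab]; simp [hfdef])
  have ha0 : a ≠ 0 := fun h => hab_ne <| by
    rw [h] at hfab ⊢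
    exact (hzero b (by rw [← hfab]; simp [hfdef])).symm
  obtain ⟨α, hα, hα'⟩ := exists_inward_path hq (hsub haB) ha0 (hre a (hsub haB))
  obtain ⟨β, hβ, hβ'⟩ := exists_inward_path hq (hsub hbB) hb0 (hre b (hsub hbB))
  have hdist : ∀ᶠ t : ℝ in 𝓝[>] 0, α t - β t ≠ 0 :=
    (hα.sub hβ).eventually_ne (sub_ne_zero.2 hab_ne)
  obtain ⟨t, ⟨ht1, ht2⟩, ⟨ht3, ht4⟩, ht5⟩ := (hα'.and (hβ'.and hdist)).exists
  have hft : f (α t) = f (β t) := by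
    change α t * Complex.exp (q (α t)) = β t * Complex.exp (q (β t))
    rw [ht1, ht3]
    exact congrArg _ hfab
  rw [mem_closedBall_zero_iff] at haB hbB
  have hmem : (α t, β t) ∈ E := by
    refine ⟨⟨⟨?_, ?_⟩, sub_eq_zero.2 hft⟩, fun h => sub_ne_zero.1 ht5 (interior_subset h hft)⟩
    · exact mem_closedBall_zero_iff.2 (ht2.le.trans haB)
    · exact mem_closedBall_zero_iff.2 (ht4.le.trans hbB)
  have : ‖a‖ + ‖b‖ ≤ ‖α t‖ + ‖β t‖ := hmin hmem
  linarith

end MaMinda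

/-! ### Real coefficients and the growth bound. -/

namespace MaMinda

lemma ofReal_mem_disk {x : ℝ} (hx : x ∈ Set.Ioo (-1 : ℝ) 1) : (x : ℂ) ∈ disk := by
  rw [mem_disk, Complex.norm_real, Real.norm_eq_abs]
  exact abs_lt.2 hx

lemma conj_mem_disk {z : ℂ} (hz : z ∈ disk) : (starRingEnd ℂ) z ∈ disk := by
  rw [mem_disk] at hz ⊢
  rwa [RCLike.norm_conj]

/-- Functions with real Taylor coefficients commute with conjugation. -/
lemma map_conj_of_im_taylorCoeff_eq_zero {f : ℂ → ℂ} (hf : DifferentiableOn ℂ f disk)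
    (him : ∀ n, (taylorCoeff f n).im = 0) {z : ℂ} (hz : z ∈ disk) :
    f ((starRingEnd ℂ) z) = (starRingEnd ℂ) (f z) := by
  have h1 := hasSum_taylorCoeff hf (conj_mem_disk hz)
  have h2 := (hasSum_taylorCoeff hf hz).mapL (Complex.conjCLE : ℂ →L[ℝ] ℂ)
  refine h1.unique (h2.congr_fun ?_ |> id)
  intro n
  simp [Complex.conj_eq_iff_im.2 (him n)]

lemma im_eq_zero_of_im_taylorCoeff_eq_zero {f : ℂ → ℂ} (hf : DifferentiableOn ℂ f disk)
    (him : ∀ n, (taylorCoeff f n).im = 0) {x : ℝ} (hx : x ∈ Set.Ioo (-1 : ℝ) 1) :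
    (f x).im = 0 := by
  have := map_conj_of_im_taylorCoeff_eq_zero hf him (ofReal_mem_disk hx)
  rw [Complex.conj_ofReal] at this
  exact Complex.conj_eq_iff_im.1 this.symm

lemma hasSum_re_taylorCoeff {f : ℂ → ℂ} (hf : DifferentiableOn ℂ f disk) {x : ℝ}
    (hx : x ∈ Set.Ioo (-1 : ℝ) 1) :
    HasSum (fun n => (taylorCoeff f n).re * x ^ n) (f x).re := by
  have := Complex.hasSum_re (hasSum_taylorCoeff hf (ofReal_mem_disk hx))
  refine this.congr_fun ?_
  intro n
  rw [← Complex.ofReal_pow, Complex.re_mul_ofReal]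

lemma continuousOn_re_ofReal {f : ℂ → ℂ} (hf : DifferentiableOn ℂ f disk) :
    ContinuousOn (fun x : ℝ => (f x).re) (Set.Ioo (-1) 1) :=
  Complex.continuous_re.comp_continuousOn
    (hf.continuousOn.comp Complex.continuous_ofReal.continuousOn fun _ hx => ofReal_mem_disk hx)

lemma hasDerivAt_re_ofReal {f : ℂ → ℂ} (hf : DifferentiableOn ℂ f disk) {x : ℝ}
    (hx : x ∈ Set.Ioo (-1 : ℝ) 1) :
    HasDerivAt (fun x : ℝ => (f x).re) (deriv f x).re x :=
  (hasDerivAt_of_mem_disk hf (ofReal_mem_disk hx)).real_of_complex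

section

variable {φ : ℂ → ℂ}

lemma IsMaMinda.im_taylorCoeff (hφ : IsMaMinda φ)
    (hpos : ∀ n : ℕ, 1 ≤ n → 0 < (taylorCoeff φ n).re ∧ (taylorCoeff φ n).im = 0) (n : ℕ) :
    (taylorCoeff φ n).im = 0 := by
  rcases n with _ | n
  · simp [taylorCoeff_zero, hφ.map_zero]
  · exact (hpos _ (by omega)).2

lemma IsMaMinda.norm_taylorCoeff (hφ : IsMaMinda φ)
    (hpos : ∀ n : ℕ, 1 ≤ n → 0 < (taylorCoeff φ n).re ∧ (taylorCoeff φ n).im = 0) (n : ℕ) :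
    ‖taylorCoeff φ n‖ = (taylorCoeff φ n).re := by
  have him := hφ.im_taylorCoeff hpos n
  have hre : 0 ≤ (taylorCoeff φ n).re := by
    rcases n with _ | n
    · simp [taylorCoeff_zero, hφ.map_zero]
    · exact (hpos _ (by omega)).1.le
  rw [Complex.norm_eq_sqrt_sq_add_sq, him]
  simp [Real.sqrt_sq hre]

lemma IsMaMinda.majorantSum_le (hφ : IsMaMinda φ)
    (hpos : ∀ n : ℕ, 1 ≤ n → 0 < (taylorCoeff φ n).re ∧ (taylorCoeff φ n).im = 0) {r : ℝ}
    (h0 : 0 ≤ r) (h1 : r < 1) (N : ℕ) : majorantSum φ r N ≤ (φ r).re := by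
  have := hasSum_re_taylorCoeff hφ.analytic (x := r) ⟨by linarith, h1⟩
  simp only [← hφ.norm_taylorCoeff hpos] at this
  exact sum_le_hasSum _ (fun n _ => by positivity) this

/-- On the real axis `φ` is real, continuous and injective, hence monotone; positivity of the
coefficients gives `φ (1/2) ≥ 1 = φ 0`, which fixes the direction. -/
lemma IsMaMinda.strictMonoOn_re (hφ : IsMaMinda φ)
    (hpos : ∀ n : ℕ, 1 ≤ n → 0 < (taylorCoeff φ n).re ∧ (taylorCoeff φ n).im = 0) :
    StrictMonoOn (fun x : ℝ => (φ x).re) (Set.Ioo (-1) 1) := by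
  have hinj : Set.InjOn (fun x : ℝ => (φ x).re) (Set.Ioo (-1) 1) := by
    intro x hx y hy hxy
    have := hφ.univalent (ofReal_mem_disk hx) (ofReal_mem_disk hy) (Complex.ext hxy (by
      rw [im_eq_zero_of_im_taylorCoeff_eq_zero hφ.analytic (hφ.im_taylorCoeff hpos) hx,
        im_eq_zero_of_im_taylorCoeff_eq_zero hφ.analytic (hφ.im_taylorCoeff hpos) hy]))
    exact_mod_cast this
  refine (ContinuousOn.strictMonoOn_of_injOn_Ioo (by norm_num)
    (continuousOn_re_ofReal hφ.analytic) hinj).resolve_right fun hanti => ?_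
  have h1 := hanti (a := 0) (by norm_num) (b := 1 / 2) (by norm_num) (by norm_num)
  have h2 := hφ.majorantSum_le hpos (r := 1 / 2) (by norm_num) (by norm_num) 0
  simp only [majorantSum_zero, hφ.map_zero, norm_one] at h2
  simp only [Complex.ofReal_zero, hφ.map_zero, Complex.one_re] at h1
  linarith

/-- By symmetry `φ (conj w) = conj (φ w) = φ w`, and univalence gives `conj w = w`. -/
lemma IsMaMinda.eq_ofReal_of_im_eq_zero (hφ : IsMaMinda φ)
    (hpos : ∀ n : ℕ, 1 ≤ n → 0 < (taylorCoeff φ n).re ∧ (taylorCoeff φ n).im = 0) {w : ℂ}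
    (hw : w ∈ disk) (him : (φ w).im = 0) : w = (w.re : ℂ) := by
  have h1 := map_conj_of_im_taylorCoeff_eq_zero hφ.analytic (hφ.im_taylorCoeff hpos) hw
  rw [Complex.conj_eq_iff_im.2 him] at h1
  exact (Complex.conj_eq_iff_re.1 (hφ.univalent (conj_mem_disk hw) hw h1)).symm

/-- The sharp lower growth bound for functions whose logarithmic derivative is subordinate to a
Ma-Minda function with positive coefficients. -/
lemma IsMaMinda.re_exponent_ge (hφ : IsMaMinda φ)
    (hpos : ∀ n : ℕ, 1 ≤ n → 0 < (taylorCoeff φ n).re ∧ (taylorCoeff φ n).im = 0)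
    {Q q ω : ℂ → ℂ} (hQ : DifferentiableOn ℂ Q disk) (hQ0 : Q 0 = 0)
    (hQφ : ∀ z ∈ disk, z * deriv Q z = φ z - 1)
    (hω : DifferentiableOn ℂ ω disk) (hmaps : Set.MapsTo ω disk disk) (hω0 : ω 0 = 0)
    (hq : DifferentiableOn ℂ q disk) (hq0 : q 0 = 0)
    (hqω : ∀ z ∈ disk, z * deriv q z = φ (ω z) - 1) {z : ℂ} (hz : z ∈ disk) :
    (Q ((-‖z‖ : ℝ) : ℂ)).re ≤ (q z).re := by
  set R := ‖z‖ with hR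
  have hR1 : R < 1 := mem_disk.1 hz
  have hsub : Metric.closedBall (0 : ℂ) R ⊆ disk := Metric.closedBall_subset_ball hR1
  have hIoo : ∀ {w : ℂ}, w ∈ disk → -‖w‖ ∈ Set.Ioo (-1 : ℝ) 1 := fun {w} hw =>
    ⟨by linarith [mem_disk.1 hw], by linarith [norm_nonneg w]⟩
  refine le_of_forall_pos_le_add fun ε hε => ?_
  -- It suffices that `u` has its minimum at `0`. At a minimum `w ≠ 0`, rotation makes `w q'(w)`
  -- real, so `φ (ω w)` and then `ω w` are real. Schwarz's lemma and monotonicity on the axis give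
  -- `φ (ω w) ≥ φ (-|w|)`, so `u` strictly decreases inward; the `ε` term supplies strictness. No
  -- minimum of `Re φ` over circles is needed.
  set u : ℂ → ℝ := fun w => (q w).re - (Q ((-‖w‖ : ℝ) : ℂ)).re + ε * ‖w‖ with hu
  have huc : ContinuousOn u (Metric.closedBall 0 R) := by
    refine ((Complex.continuous_re.comp_continuousOn (hq.continuousOn.mono hsub)).sub ?_).add
      (by fun_prop)
    exact (continuousOn_re_ofReal hQ).comp (f := fun w : ℂ => -‖w‖) (by fun_prop)
      fun w hw => hIoo (hsub hw)
  obtain ⟨w, hw, hmin⟩ := (isCompact_closedBall (0 : ℂ) R).exists_isMinOn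
    ⟨0, by simp [hR]⟩ huc
  have hu0 : u 0 = 0 := by simp [hu, hq0, hQ0]
  have hwd := hsub hw
  have hwR : ‖w‖ ≤ R := mem_closedBall_zero_iff.1 hw
  suffices h : w = 0 by
    have h1 : u w ≤ u z := hmin (mem_closedBall_zero_iff.2 le_rfl)
    rw [h, hu0] at h1
    simp only [hu, ← hR] at h1
    nlinarith
  by_contra hw0
  have hρ : 0 < ‖w‖ := norm_pos_iff.2 hw0
  have hqd := hasDerivAt_of_mem_disk hq hwd
  have him : (w * deriv q w).im = 0 := by
    have hc : HasDerivAt (fun t : ℝ => w * Complex.exp (t * Complex.I)) (w * Complex.I) 0 := by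
      have h1 : HasDerivAt (fun t : ℝ => (t : ℂ)) 1 0 := Complex.ofRealCLM.hasDerivAt
      simpa using ((h1.mul_const Complex.I).cexp).const_mul w
    have hqd' : HasDerivAt q (deriv q w) (w * Complex.exp (((0 : ℝ) : ℂ) * Complex.I)) := by
      simpa using hqd
    have h2 := hqd'.comp (0 : ℝ) hc
    have h3 : HasDerivAt (fun t : ℝ => (q (w * Complex.exp (t * Complex.I))).re)
        (deriv q w * (w * Complex.I)).re 0 :=
      Complex.reCLM.hasFDerivAt.comp_hasDerivAt (0 : ℝ) h2
    have h4 : IsLocalMin (fun t : ℝ => (q (w * Complex.exp (t * Complex.I))).re) 0 := by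
      refine Eventually.of_forall fun t => ?_
      have hn : ‖w * Complex.exp (t * Complex.I)‖ = ‖w‖ := by
        rw [norm_mul, Complex.norm_exp_ofReal_mul_I, mul_one]
      have h5 : u w ≤ u (w * Complex.exp (t * Complex.I)) :=
        hmin (mem_closedBall_zero_iff.2 (by rw [hn]; exact hwR))
      simp only [hu, hn] at h5
      simp only [Complex.ofReal_zero, zero_mul, Complex.exp_zero, mul_one]
      linarith
    have h6 := h4.hasDerivAt_eq_zero h3
    rw [show deriv q w * (w * Complex.I) = (w * deriv q w) * Complex.I by ring,
      Complex.mul_I_re] at h6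
    linarith
  have hωw := hmaps hwd
  have hφim : (φ (ω w)).im = 0 := by
    have := hqω w hwd
    rw [show φ (ω w) = w * deriv q w + 1 by rw [this]; ring]
    simp [him]
  have hωr := hφ.eq_ofReal_of_im_eq_zero hpos hωw hφim
  have hωn : ‖ω w‖ ≤ ‖w‖ :=
    Complex.norm_le_norm_of_mapsTo_ball hω
      (hmaps.mono_right Metric.ball_subset_closedBall) hω0 (mem_disk.1 hwd)
  have hge : (φ ((-‖w‖ : ℝ) : ℂ)).re ≤ (φ (ω w)).re := by
    rw [hωr]
    have h1 : |(ω w).re| ≤ ‖w‖ := (Complex.abs_re_le_norm _).trans hωn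
    have h2 := abs_le.1 h1
    refine (hφ.strictMonoOn_re hpos).monotoneOn (hIoo hwd) ?_ h2.1
    exact ⟨by linarith [mem_disk.1 hwd], by linarith [mem_disk.1 hwd]⟩
  have hrad : HasDerivAt (fun t : ℝ => u ((1 - (t : ℂ)) * w))
      (-(w * deriv q w).re + ((φ ((-‖w‖ : ℝ) : ℂ)).re - 1) - ε * ‖w‖) 0 := by
    have h1 : HasDerivAt (fun t : ℝ => (1 - (t : ℂ)) * w) (-w) 0 := by
      have h1 : HasDerivAt (fun t : ℝ => (t : ℂ)) 1 0 := Complex.ofRealCLM.hasDerivAt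
      simpa using (h1.const_sub 1).mul_const w
    have hqd' : HasDerivAt q (deriv q w) ((1 - ((0 : ℝ) : ℂ)) * w) := by simpa using hqd
    have h2 : HasDerivAt (fun t : ℝ => (q ((1 - (t : ℂ)) * w)).re) (deriv q w * -w).re 0 :=
      Complex.reCLM.hasFDerivAt.comp_hasDerivAt (0 : ℝ) (hqd'.comp (0 : ℝ) h1)
    have h3 : HasDerivAt (fun t : ℝ => (1 - t) * ‖w‖) (-‖w‖) 0 := by
      simpa using ((hasDerivAt_id (0 : ℝ)).const_sub 1).mul_const ‖w‖
    have h4 : HasDerivAt (fun x : ℝ => (Q x).re) (deriv Q ((-‖w‖ : ℝ) : ℂ)).re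
        (-((1 - (0 : ℝ)) * ‖w‖)) := by
      simpa using hasDerivAt_re_ofReal hQ (hIoo hwd)
    have h5 := h4.comp (0 : ℝ) h3.neg
    have h6 := (h2.sub h5).add (h3.const_mul ε)
    have h7 : ((-‖w‖ : ℝ) : ℂ) * deriv Q ((-‖w‖ : ℝ) : ℂ) = φ ((-‖w‖ : ℝ) : ℂ) - 1 :=
      hQφ _ (ofReal_mem_disk (hIoo hwd))
    have h8 := congrArg Complex.re h7
    rw [Complex.re_ofReal_mul, Complex.sub_re, Complex.one_re] at h8
    have h9 : HasDerivAt (fun t : ℝ => (q ((1 - (t : ℂ)) * w)).re -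
        (Q ((-((1 - t) * ‖w‖) : ℝ) : ℂ)).re + ε * ((1 - t) * ‖w‖))
        (-(w * deriv q w).re + ((φ ((-‖w‖ : ℝ) : ℂ)).re - 1) - ε * ‖w‖) 0 := by
      refine h6.congr_deriv ?_
      rw [← h8, show deriv q w * -w = -(w * deriv q w) by ring, Complex.neg_re]
      ring
    refine h9.congr_of_eventuallyEq ?_
    filter_upwards [Iio_mem_nhds (zero_lt_one (α := ℝ))] with t ht
    have hn : ‖(1 - (t : ℂ)) * w‖ = (1 - t) * ‖w‖ := by
      rw [norm_mul, ← Complex.ofReal_one, ← Complex.ofReal_sub, Complex.norm_real,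
        Real.norm_of_nonneg (by linarith [Set.mem_Iio.1 ht])]
    simp only [hu, hn]
  have hneg : -(w * deriv q w).re + ((φ ((-‖w‖ : ℝ) : ℂ)).re - 1) - ε * ‖w‖ < 0 := by
    rw [hqω w hwd, Complex.sub_re, Complex.one_re]
    have := mul_pos hε hρ
    linarith
  have hslope := hrad.tendsto_slope_zero_right
  obtain ⟨t, ht1, ht2⟩ := ((hslope.eventually_lt_const hneg).and
    (Ioo_mem_nhdsGT (zero_lt_one (α := ℝ)))).exists
  simp only [zero_add, Complex.ofReal_zero, sub_zero, one_mul, smul_eq_mul] at ht1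
  have hmem : (1 - (t : ℂ)) * w ∈ Metric.closedBall (0 : ℂ) R := by
    rw [mem_closedBall_zero_iff, norm_mul, ← Complex.ofReal_one, ← Complex.ofReal_sub,
      Complex.norm_real, Real.norm_of_nonneg (by linarith [ht2.2])]
    nlinarith [ht2.1, ht2.2]
  have h1 : u w ≤ u ((1 - (t : ℂ)) * w) := hmin hmem
  have h2 : 0 ≤ t⁻¹ * (u ((1 - (t : ℂ)) * w) - u w) :=
    mul_nonneg (inv_nonneg.2 ht2.1.le) (by linarith)
  linarith

end

end MaMinda

/-! ### Distance to the boundary of the image. -/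

namespace MaMinda

section

variable {f : ℂ → ℂ}

lemma isOpen_image_of_deriv_ne_zero (hf : DifferentiableOn ℂ f disk)
    (hd : ∀ z ∈ disk, deriv f z ≠ 0) {s : Set ℂ} (hs : IsOpen s) (hsub : s ⊆ disk) :
    IsOpen (f '' s) := by
  rw [isOpen_iff_mem_nhds]
  rintro _ ⟨z, hz, rfl⟩
  have h1 : HasStrictDerivAt f (deriv f z) z :=
    (analyticAt_of_mem_disk hf (hsub hz)).hasStrictDerivAt
  rw [← h1.map_nhds_eq (hd z (hsub hz))]
  exact image_mem_map (hs.mem_nhds hz)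

/-- A univalent function on the disk is not onto the plane. -/
lemma image_disk_ne_univ (hf : DifferentiableOn ℂ f disk) (hinj : Set.InjOn f disk)
    (hd : ∀ z ∈ disk, deriv f z ≠ 0) : f '' disk ≠ Set.univ := by
  intro huniv
  set g := Function.invFunOn f disk
  have hleft : ∀ z ∈ disk, g (f z) = z := fun z hz => hinj.leftInvOn_invFunOn hz
  -- The inverse of a surjective `f` would be a bounded entire function, contradicting Liouville's
  -- theorem.
  have hgd : Differentiable ℂ g := by
    intro y
    obtain ⟨z, hz, rfl⟩ : y ∈ f '' disk := huniv ▸ Set.mem_univ y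
    have h1 : HasStrictDerivAt f (deriv f z) z :=
      (analyticAt_of_mem_disk hf hz).hasStrictDerivAt
    have h2 : ∀ᶠ x in 𝓝 z, g (f x) = x := by
      filter_upwards [disk_mem_nhds hz] with x hx using hleft x hx
    exact (h1.to_local_left_inverse (hd z hz) h2).hasDerivAt.differentiableAt
  have hb : Bornology.IsBounded (Set.range g) := by
    refine (Metric.isBounded_ball (x := (0 : ℂ)) (r := 1)).subset ?_
    rintro _ ⟨y, rfl⟩
    obtain ⟨z, hz, rfl⟩ : y ∈ f '' disk := huniv ▸ Set.mem_univ y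
    rw [hleft z hz]
    exact hz
  have h3 := hgd.apply_eq_apply_of_bounded hb (f 0) (f (1 / 2))
  have hhalf : (1 / 2 : ℂ) ∈ disk := by rw [mem_disk]; norm_num
  rw [hleft 0 zero_mem_disk, hleft _ hhalf] at h3
  norm_num at h3

/-- For `s < L`, the image is covered by a closed set: the compact image of a smaller disk together
with `{y | s ≤ |y|}`. A frontier point of modulus below `s` would lie in the first piece, hence in
the open image. -/
lemma le_boundaryDist (hf : DifferentiableOn ℂ f disk) (hinj : Set.InjOn f disk)
    (hd : ∀ z ∈ disk, deriv f z ≠ 0) (hf0 : f 0 = 0) {L : ℝ}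
    (hL : ∀ s < L, ∃ r < 1, ∀ z ∈ disk, r < ‖z‖ → s < ‖f z‖) : L ≤ boundaryDist f := by
  have hopen : IsOpen (f '' disk) := isOpen_image_of_deriv_ne_zero hf hd isOpen_disk subset_rfl
  -- Needed because `infDist` to the empty set is `0`.
  have hne : (frontier (f '' disk)).Nonempty := by
    rw [nonempty_frontier_iff]
    exact ⟨⟨f 0, 0, zero_mem_disk, rfl⟩, image_disk_ne_univ hf hinj hd⟩
  rw [boundaryDist, Metric.le_infDist hne]
  intro w hw
  rw [hf0, dist_zero_left]
  by_contra! hlt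
  obtain ⟨s, hs1, hs2⟩ := exists_between hlt
  obtain ⟨r, hr1, hr⟩ := hL s hs2
  have hsub : Metric.closedBall (0 : ℂ) r ⊆ disk := Metric.closedBall_subset_ball hr1
  have hcl : IsClosed (f '' Metric.closedBall (0 : ℂ) r ∪ {y | s ≤ ‖y‖}) :=
    (((isCompact_closedBall _ _).image_of_continuousOn
      (hf.continuousOn.mono hsub)).isClosed).union (isClosed_le continuous_const continuous_norm)
  have hcov : f '' disk ⊆ f '' Metric.closedBall (0 : ℂ) r ∪ {y | s ≤ ‖y‖} := by
    rintro _ ⟨z, hz, rfl⟩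
    by_cases h : ‖z‖ ≤ r
    · exact Or.inl ⟨z, mem_closedBall_zero_iff.2 h, rfl⟩
    · exact Or.inr (hr z hz (not_le.1 h)).le
  rcases closure_minimal hcov hcl hw.1 with h | h
  · exact hw.2 (by rw [hopen.interior_eq]; exact Set.image_mono hsub h)
  · exact absurd (show s ≤ ‖w‖ from h) (not_le.2 hs1)

/-- The limit `m` is not a value: if `m = f z`, the image of a small disk containing `z` is a
neighbourhood of `m`, so it contains `f (-r)` for `r` near `1`, against injectivity. Thus `m` is a
frontier point. -/
lemma boundaryDist_le_of_tendsto (hf : DifferentiableOn ℂ f disk) (hinj : Set.InjOn f disk)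
    (hd : ∀ z ∈ disk, deriv f z ≠ 0) (hf0 : f 0 = 0) {m : ℂ}
    (hm : Tendsto (fun r : ℝ => f (-(r : ℂ))) (𝓝[<] 1) (𝓝 m)) : boundaryDist f ≤ ‖m‖ := by
  have hmem : ∀ᶠ r : ℝ in 𝓝[<] 1, -(r : ℂ) ∈ disk := by
    filter_upwards [Ioo_mem_nhdsLT (zero_lt_one (α := ℝ))] with r hr
    rw [mem_disk, norm_neg, Complex.norm_real, Real.norm_of_nonneg hr.1.le]
    exact hr.2
  have hnot : m ∉ f '' disk := by
    rintro ⟨z, hz, rfl⟩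
    obtain ⟨ρ, hρ1, hρ2⟩ := exists_between (mem_disk.1 hz)
    have hsub : Metric.ball (0 : ℂ) ρ ⊆ disk := Metric.ball_subset_ball hρ2.le
    have hnhds : f '' Metric.ball (0 : ℂ) ρ ∈ 𝓝 (f z) :=
      (isOpen_image_of_deriv_ne_zero hf hd Metric.isOpen_ball hsub).mem_nhds
        ⟨z, mem_ball_zero_iff.2 hρ1, rfl⟩
    obtain ⟨r, ⟨x, hx, hxr⟩, hr, hr1⟩ := ((hm.eventually hnhds).and
      (hmem.and (Ioo_mem_nhdsLT hρ2))).exists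
    have h1 := hinj (hsub hx) hr hxr
    rw [h1, mem_ball_zero_iff, norm_neg, Complex.norm_real,
      Real.norm_of_nonneg ((norm_nonneg z).trans (hρ1.le.trans hr1.1.le))] at hx
    exact lt_asymm hx hr1.1
  have hfr : m ∈ frontier (f '' disk) := by
    refine ⟨mem_closure_of_tendsto hm ?_, fun h => hnot (interior_subset h)⟩
    filter_upwards [hmem] with r hr using ⟨_, hr, rfl⟩
  have := Metric.infDist_le_dist_of_mem (x := f 0) hfr
  rwa [hf0, dist_zero_left, ← hf0] at this

end

/-! ### Majorants of exponentials. -/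

lemma deriv_exp_eqOn {q : ℂ → ℂ} (hq : DifferentiableOn ℂ q disk) :
    Set.EqOn (deriv fun z => Complex.exp (q z)) (fun z => deriv q z * Complex.exp (q z)) disk := by
  intro z hz
  rw [(hasDerivAt_of_mem_disk hq hz).cexp.deriv, mul_comm]

/-- The differential equation satisfied by an exponential, as an inequality of majorant sums. -/
lemma majorantSum_deriv_le {q : ℂ → ℂ} (hq : DifferentiableOn ℂ q disk) {r : ℝ} (hr : 0 ≤ r)
    (N : ℕ) : majorantSum (deriv fun z => Complex.exp (q z)) r N ≤
      majorantSum (deriv q) r N * majorantSum (fun z => Complex.exp (q z)) r (N + 1) := by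
  have h1 : majorantSum (deriv fun z => Complex.exp (q z)) r N =
      majorantSum (fun z => deriv q z * Complex.exp (q z)) r N :=
    Finset.sum_congr rfl fun k _ => by rw [taylorCoeff_congr_disk (deriv_exp_eqOn hq)]
  rw [h1]
  have hqa := analyticAt_of_mem_disk hq zero_mem_disk
  refine (majorantSum_mul_le hqa.deriv hqa.cexp hr N).trans ?_
  refine mul_le_mul_of_nonneg_left ?_ (majorantSum_nonneg _ hr N)
  -- The extra nonnegative term makes this a closed differential inequality: the truncation at `N +
  -- 1` has as derivative the truncation of `f'` at `N`.
  rw [majorantSum, majorantSum, Finset.sum_range_succ _ (N + 1)]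
  exact le_add_of_nonneg_right (by positivity)

lemma hasDerivAt_majorantSum (f : ℂ → ℂ) (r : ℝ) (N : ℕ) :
    HasDerivAt (fun r => majorantSum f r (N + 1)) (majorantSum (deriv f) r N) r := by
  simp only [majorantSum_succ']
  have h1 : HasDerivAt (fun r : ℝ => ∑ k ∈ Finset.range (N + 1),
      ‖taylorCoeff f (k + 1)‖ * r ^ (k + 1)) (majorantSum (deriv f) r N) r := by
    refine HasDerivAt.fun_sum fun k _ => ?_
    have h2 := (hasDerivAt_pow (k + 1) r).const_mul ‖taylorCoeff f (k + 1)‖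
    refine h2.congr_deriv ?_
    rw [taylorCoeff_deriv, norm_mul]
    have h3 : ‖(k : ℂ) + 1‖ = k + 1 := by
      rw [← Nat.cast_add_one, Complex.norm_natCast]; simp
    rw [h3]
    push_cast
    ring
  refine (h1.const_add ‖f 0‖).congr_of_eventuallyEq (Eventually.of_forall fun x => ?_)
  simp only [Finset.mul_sum]
  congr 1
  exact Finset.sum_congr rfl fun k _ => by ring

lemma taylorCoeff_deriv_exponent {p q : ℂ → ℂ} (hq : DifferentiableOn ℂ q disk)
    (hqp : ∀ z ∈ disk, z * deriv q z = p z - 1) (n : ℕ) :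
    taylorCoeff (deriv q) n = taylorCoeff p (n + 1) := by
  have h1 : Set.EqOn p (fun z => 1 + z * deriv q z) disk := fun z hz => by
    simp only [hqp z hz]; ring
  rw [taylorCoeff_congr_disk h1, taylorCoeff_const_add_succ, taylorCoeff_id_mul]
  exact (analyticAt_of_mem_disk hq zero_mem_disk).deriv

section

variable {φ Q q ω : ℂ → ℂ}

/-- Grönwall's argument: subordination bounds the majorant sum of `q'` by `Q'(x)`, so the majorant
sum `F` of `exp q` satisfies `F' ≤ Q' F`, and `F * exp (-Q)` decreases from `1`. -/
lemma IsMaMinda.majorantSum_exp_le (hφ : IsMaMinda φ)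
    (hpos : ∀ n : ℕ, 1 ≤ n → 0 < (taylorCoeff φ n).re ∧ (taylorCoeff φ n).im = 0)
    (hQ : DifferentiableOn ℂ Q disk) (hQ0 : Q 0 = 0)
    (hQφ : ∀ z ∈ disk, z * deriv Q z = φ z - 1)
    (hω : DifferentiableOn ℂ ω disk) (hmaps : Set.MapsTo ω disk disk) (hω0 : ω 0 = 0)
    (hq : DifferentiableOn ℂ q disk) (hq0 : q 0 = 0)
    (hqω : ∀ z ∈ disk, z * deriv q z = φ (ω z) - 1) {r : ℝ} (hr : 0 ≤ r) (hr3 : r ≤ 1 / 3)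
    (N : ℕ) :
    majorantSum (fun z => Complex.exp (q z)) r (N + 1) ≤ Real.exp (Q r).re := by
  have hIoo : ∀ {x : ℝ}, x ∈ Set.Icc (0 : ℝ) (1 / 3) → x ∈ Set.Ioo (-1 : ℝ) 1 := fun hx =>
    ⟨by linarith [hx.1], by linarith [hx.2]⟩
  have hK : ∀ x ∈ Set.Ioo (0 : ℝ) (1 / 3), majorantSum (deriv q) x N ≤ (deriv Q x).re := by
    intro x hx
    have hx' := hIoo ⟨hx.1.le, hx.2.le⟩
    have h1 : majorantSum (fun z => φ (ω z)) x (N + 1) ≤ (φ x).re :=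
      (majorantSum_comp_le hω hmaps hω0 hx.1.le hx.2.le (N + 1) φ hφ.analytic).trans
        (hφ.majorantSum_le hpos hx.1.le hx'.2 (N + 1))
    rw [majorantSum_succ', hω0, hφ.map_zero, norm_one] at h1
    simp only [← taylorCoeff_deriv_exponent (p := fun z => φ (ω z)) hq hqω] at h1
    have h2 := congrArg Complex.re (hQφ x (ofReal_mem_disk hx'))
    rw [Complex.re_ofReal_mul, Complex.sub_re, Complex.one_re] at h2
    have h3 : x * majorantSum (deriv q) x N ≤ x * (deriv Q x).re := by
      rw [h2, majorantSum]; linarith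
    exact le_of_mul_le_mul_left h3 hx.1
  set F : ℝ → ℝ := fun x => majorantSum (fun z => Complex.exp (q z)) x (N + 1) with hF
  have hd : ∀ x ∈ Set.Icc (0 : ℝ) (1 / 3), HasDerivAt (fun x => F x * Real.exp (-(Q x).re))
      (majorantSum (deriv fun z => Complex.exp (q z)) x N * Real.exp (-(Q x).re) +
        F x * (Real.exp (-(Q x).re) * -(deriv Q x).re)) x := fun x hx =>
    (hasDerivAt_majorantSum _ x N).mul (hasDerivAt_re_ofReal hQ (hIoo hx)).neg.exp
  have hanti : AntitoneOn (fun x => F x * Real.exp (-(Q x).re)) (Set.Icc 0 (1 / 3)) := by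
    refine antitoneOn_of_deriv_nonpos (convex_Icc _ _)
      (fun x hx => (hd x hx).continuousAt.continuousWithinAt) ?_ ?_
    · intro x hx
      exact (hd x (interior_subset hx)).differentiableAt.differentiableWithinAt
    · intro x hx
      rw [(hd x (interior_subset hx)).deriv]
      rw [interior_Icc] at hx
      have h1 := majorantSum_deriv_le hq hx.1.le N
      have h2 := mul_le_mul_of_nonneg_right (hK x hx)
        (majorantSum_nonneg (fun z => Complex.exp (q z)) hx.1.le (N + 1))
      have h3 : majorantSum (deriv fun z => Complex.exp (q z)) x N ≤ (deriv Q x).re * F x :=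
        h1.trans h2
      have h4 := mul_le_mul_of_nonneg_right h3 (Real.exp_pos (-(Q x).re)).le
      linarith
  have h0 := hanti (a := 0) (by norm_num) (b := r) ⟨hr, hr3⟩ hr
  have hF0 : F 0 = 1 := by
    simp only [hF, majorantSum_succ', hq0, Complex.exp_zero, norm_one, zero_mul, add_zero]
  simp only [hF0, Complex.ofReal_zero, hQ0, Complex.zero_re, neg_zero, Real.exp_zero, mul_one,
    Real.exp_neg] at h0
  rwa [← div_eq_mul_inv, div_le_one (Real.exp_pos _)] at h0

end

lemma taylorCoeff_eq_of_eq_mul_exp {f q : ℂ → ℂ} (hq : DifferentiableOn ℂ q disk)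
    (hfq : ∀ z ∈ disk, f z = z * Complex.exp (q z)) (n : ℕ) :
    taylorCoeff f (n + 1) = taylorCoeff (fun z => Complex.exp (q z)) n := by
  rw [taylorCoeff_congr_disk hfq, taylorCoeff_id_mul]
  exact (analyticAt_of_mem_disk hq zero_mem_disk).cexp

lemma add_sum_majorantTerm {f q : ℂ → ℂ} (hq : DifferentiableOn ℂ q disk) (hq0 : q 0 = 0)
    (hfq : ∀ z ∈ disk, f z = z * Complex.exp (q z)) (r : ℝ) (N : ℕ) :
    r + ∑ n ∈ Finset.range (N + 1), majorantTerm f r n =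
      r * majorantSum (fun z => Complex.exp (q z)) r (N + 1) := by
  rw [majorantSum_succ', hq0, Complex.exp_zero, norm_one, mul_add, mul_one, Finset.mul_sum,
    Finset.mul_sum]
  congr 1
  refine Finset.sum_congr rfl fun n _ => ?_
  rw [majorantTerm, taylorCoeff_eq_of_eq_mul_exp hq hfq]
  ring

open scoped ComplexOrder in
-- The equation `(exp q)' = q' * exp q` gives a recursion expressing `(n + 1) c_(n+1)` through
-- products of earlier nonnegative terms.
lemma taylorCoeff_exp_nonneg {q : ℂ → ℂ} (hq : DifferentiableOn ℂ q disk) (hq0 : q 0 = 0)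
    (hnn : ∀ n, 0 ≤ taylorCoeff (deriv q) n) (n : ℕ) :
    0 ≤ taylorCoeff (fun z => Complex.exp (q z)) n := by
  have hqa := analyticAt_of_mem_disk hq zero_mem_disk
  induction n using Nat.strong_induction_on with
  | _ n ih =>
    rcases n with _ | n
    · simp [taylorCoeff_zero, hq0]
    · have h1 := taylorCoeff_deriv (fun z => Complex.exp (q z)) n
      rw [taylorCoeff_congr_disk (deriv_exp_eqOn hq),
        taylorCoeff_mul (g := fun z => Complex.exp (q z)) hqa.deriv hqa.cexp] at h1
      have h2 : 0 ≤ ((n : ℂ) + 1) * taylorCoeff (fun z => Complex.exp (q z)) (n + 1) := by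
        rw [← h1]
        exact Finset.sum_nonneg fun i _ => mul_nonneg (hnn i) (ih _ (by omega))
      have h3 : (0 : ℂ) < (n : ℂ) + 1 := by exact_mod_cast n.succ_pos
      exact le_of_mul_le_mul_left (by simpa using h2) h3

open scoped ComplexOrder in
/-- The majorant series of `z exp (q z)` when the coefficients are nonnegative. -/
lemma hasSum_majorantTerm_of_nonneg {f q : ℂ → ℂ} (hq : DifferentiableOn ℂ q disk) (hq0 : q 0 = 0)
    (hfq : ∀ z ∈ disk, f z = z * Complex.exp (q z))
    (hnn : ∀ n, 0 ≤ taylorCoeff (deriv q) n) {r : ℝ} (hr : r ∈ Set.Ioo (-1 : ℝ) 1) :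
    HasSum (majorantTerm f r) (r * (Complex.exp (q r)).re - r) := by
  have h1 := hasSum_re_taylorCoeff hq.cexp hr
  have h2 := (hasSum_nat_add_iff' 1).2 h1
  have h3 := h2.mul_left r
  simp only [Finset.range_one, Finset.sum_singleton, taylorCoeff_zero, hq0, Complex.exp_zero,
    Complex.one_re, pow_zero, mul_one, mul_sub] at h3
  refine h3.congr_fun ?_
  intro n
  have h4 := taylorCoeff_exp_nonneg hq hq0 hnn (n + 1)
  rw [majorantTerm, taylorCoeff_eq_of_eq_mul_exp hq hfq]
  have h5 := congrArg Complex.re (Complex.norm_of_nonneg' h4)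
  rw [Complex.ofReal_re] at h5
  rw [h5]
  ring

end MaMinda

/-! ### The extremal function and its values on the real axis. -/

namespace MaMinda

variable {φ Q : ℂ → ℂ}

lemma IsMaMinda.re_one_add (hφ : IsMaMinda φ) {q ω : ℂ → ℂ} (hmaps : Set.MapsTo ω disk disk)
    (hqω : ∀ z ∈ disk, z * deriv q z = φ (ω z) - 1) :
    ∀ z ∈ disk, 0 < (1 + z * deriv q z).re := by
  intro z hz
  rw [hqω z hz]
  simpa using hφ.re_pos _ (hmaps hz)

/-- Structure of the members of the Ma-Minda class. -/
lemma IsMaMinda.exists_of_mem_starlikeClass (hφ : IsMaMinda φ) {f : ℂ → ℂ}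
    (hf : f ∈ StarlikeClass φ) :
    ∃ q ω : ℂ → ℂ, DifferentiableOn ℂ ω disk ∧ Set.MapsTo ω disk disk ∧ ω 0 = 0 ∧
      DifferentiableOn ℂ q disk ∧ q 0 = 0 ∧ (∀ z ∈ disk, z * deriv q z = φ (ω z) - 1) ∧
      ∀ z ∈ disk, f z = z * Complex.exp (q z) := by
  obtain ⟨hS, ω, hω, hmaps, hω0, hfω⟩ := hf
  have hp : DifferentiableOn ℂ (fun z => φ (ω z)) disk := hφ.analytic.comp hω hmaps
  obtain ⟨q, hq, hq0, hqω⟩ := exists_exponent hp (by simp [hω0, hφ.map_zero])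
  exact ⟨q, ω, hω, hmaps, hω0, hq, hq0, hqω,
    eq_mul_exp hS.analytic hS.map_zero hS.deriv_zero (hS.mul_deriv_eq hfω) hq hq0 hqω⟩

lemma deriv_ne_zero_of_eq_mul_exp {f q : ℂ → ℂ} (hq : DifferentiableOn ℂ q disk)
    (hre : ∀ z ∈ disk, 0 < (1 + z * deriv q z).re)
    (hfq : ∀ z ∈ disk, f z = z * Complex.exp (q z)) : ∀ z ∈ disk, deriv f z ≠ 0 := by
  intro z hz
  have heq : f =ᶠ[𝓝 z] fun z => z * Complex.exp (q z) :=
    Set.EqOn.eventuallyEq_of_mem hfq (disk_mem_nhds hz)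
  rw [heq.deriv_eq, (hasDerivAt_mul_exp hq hz).deriv]
  refine mul_ne_zero (Complex.exp_ne_zero _) fun h => ?_
  have := hre z hz
  rw [h] at this
  simp at this

lemma IsMaMinda.isExtremal (hφ : IsMaMinda φ) (hQ : DifferentiableOn ℂ Q disk) (hQ0 : Q 0 = 0)
    (hQφ : ∀ z ∈ disk, z * deriv Q z = φ z - 1) :
    IsExtremal φ fun z => z * Complex.exp (Q z) := by
  refine ⟨⟨differentiableOn_id.mul hQ.cexp, by simp, ?_, ?_⟩, ?_⟩
  · rw [(hasDerivAt_mul_exp hQ zero_mem_disk).deriv]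
    simp [hQ0]
  · exact injOn_mul_exp hQ (hφ.re_one_add (Set.mapsTo_id _) hQφ)
  · intro z hz
    rw [logDerivQuotient]
    split_ifs with h0
    · rw [h0, hφ.map_zero]
    · rw [(hasDerivAt_mul_exp hQ hz).deriv, hQφ z hz]
      have := Complex.exp_ne_zero (Q z)
      field_simp
      ring

open scoped ComplexOrder in
lemma taylorCoeff_deriv_exponent_nonneg
    (hpos : ∀ n : ℕ, 1 ≤ n → 0 < (taylorCoeff φ n).re ∧ (taylorCoeff φ n).im = 0)
    (hQ : DifferentiableOn ℂ Q disk) (hQφ : ∀ z ∈ disk, z * deriv Q z = φ z - 1) (n : ℕ) :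
    0 ≤ taylorCoeff (deriv Q) n := by
  rw [taylorCoeff_deriv_exponent hQ hQφ, Complex.nonneg_iff]
  have := hpos (n + 1) (by omega)
  exact ⟨this.1.le, this.2.symm⟩

lemma im_exponent_eq_zero
    (hpos : ∀ n : ℕ, 1 ≤ n → 0 < (taylorCoeff φ n).re ∧ (taylorCoeff φ n).im = 0)
    (hQ : DifferentiableOn ℂ Q disk) (hQ0 : Q 0 = 0)
    (hQφ : ∀ z ∈ disk, z * deriv Q z = φ z - 1) {x : ℝ}
    (hx : x ∈ Set.Ioo (-1 : ℝ) 1) : (Q x).im = 0 := by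
  refine im_eq_zero_of_im_taylorCoeff_eq_zero hQ (fun n => ?_) hx
  rcases n with _ | n
  · simp [taylorCoeff_zero, hQ0]
  · have h1 := taylorCoeff_deriv Q n
    rw [taylorCoeff_deriv_exponent hQ hQφ] at h1
    have h2 := congrArg Complex.im h1
    rw [(hpos _ (by omega)).2, show ((n : ℂ) + 1) = ((n + 1 : ℝ) : ℂ) by push_cast; rfl,
      Complex.im_ofReal_mul] at h2
    have h3 : ((n : ℝ) + 1) ≠ 0 := by positivity
    exact (mul_eq_zero.1 h2.symm).resolve_left h3

/-- `Q'(x) = (φ x - 1) / x` is positive because `φ` increases through `1` at the origin; at `x = 0`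
the derivative is the first coefficient of `φ`. -/
lemma strictMonoOn_re_exponent (hφ : IsMaMinda φ)
    (hpos : ∀ n : ℕ, 1 ≤ n → 0 < (taylorCoeff φ n).re ∧ (taylorCoeff φ n).im = 0)
    (hQ : DifferentiableOn ℂ Q disk) (hQφ : ∀ z ∈ disk, z * deriv Q z = φ z - 1) :
    StrictMonoOn (fun x : ℝ => (Q x).re) (Set.Ioo (-1) 1) := by
  refine strictMonoOn_of_deriv_pos (convex_Ioo _ _) (continuousOn_re_ofReal hQ) fun x hx => ?_
  rw [interior_Ioo] at hx
  rw [(hasDerivAt_re_ofReal hQ hx).deriv]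
  have h1 := congrArg Complex.re (hQφ x (ofReal_mem_disk hx))
  rw [Complex.re_ofReal_mul, Complex.sub_re, Complex.one_re] at h1
  have hzero : (φ ((0 : ℝ) : ℂ)).re = 1 := by simp [hφ.map_zero]
  have hmono := hφ.strictMonoOn_re hpos
  rcases lt_trichotomy x 0 with h | rfl | h
  · have h2 := hmono hx (show (0 : ℝ) ∈ Set.Ioo (-1 : ℝ) 1 by norm_num) h
    simp only [hzero] at h2
    nlinarith
  · have h2 := taylorCoeff_deriv_exponent hQ hQφ 0
    rw [taylorCoeff_zero] at h2
    rw [Complex.ofReal_zero, h2]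
    exact (hpos _ le_rfl).1
  · have h2 := hmono (show (0 : ℝ) ∈ Set.Ioo (-1 : ℝ) 1 by norm_num) hx h
    simp only [hzero] at h2
    nlinarith

/-- The derivative is `exp (Re (Q x)) * Re (φ x)`, positive since `φ` has positive real part. -/
lemma strictMonoOn_mul_exp_re_exponent (hφ : IsMaMinda φ)
    (hQ : DifferentiableOn ℂ Q disk) (hQφ : ∀ z ∈ disk, z * deriv Q z = φ z - 1) :
    StrictMonoOn (fun x : ℝ => x * Real.exp (Q x).re) (Set.Ioo (-1) 1) := by
  refine strictMonoOn_of_deriv_pos (convex_Ioo _ _)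
    (continuousOn_id.mul (continuousOn_re_ofReal hQ).rexp) fun x hx => ?_
  rw [interior_Ioo] at hx
  have hd := (hasDerivAt_id x).mul (hasDerivAt_re_ofReal hQ hx).exp
  have hd' : deriv (fun x : ℝ => x * Real.exp (Q x).re) x = _ := hd.deriv
  rw [hd']
  have h1 := congrArg Complex.re (hQφ x (ofReal_mem_disk hx))
  rw [Complex.re_ofReal_mul, Complex.sub_re, Complex.one_re] at h1
  have h2 := hφ.re_pos _ (ofReal_mem_disk hx)
  have h3 := mul_pos (Real.exp_pos (Q x).re) h2
  simp only [id, one_mul]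
  nlinarith

end MaMinda

/-! ### The main theorem. -/

open MaMinda in
theorem theorem2p1 (φ : ℂ → ℂ) (hφ : IsMaMinda φ)
    (hpos : ∀ n : ℕ, 1 ≤ n → 0 < (taylorCoeff φ n).re ∧ (taylorCoeff φ n).im = 0)
    (hH2 : MemHardyTwo φ) :
    ∃ h : ℂ → ℂ, IsExtremal φ h ∧ (∀ g : ℂ → ℂ, IsExtremal φ g → Set.EqOn g h disk) ∧
      ∃ (m : ℂ) (rf : ℝ),
        -- `m` is the radial limit `h(-1)`
        Tendsto (fun r : ℝ => h (-(r : ℂ))) (𝓝[<] 1) (𝓝 m) ∧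
        IsLeast {r : ℝ | 0 < r ∧ r < 1 ∧ h (r : ℂ) + m = 0} rf ∧
        (∀ f ∈ StarlikeClass φ, ∀ r : ℝ, 0 ≤ r → r ≤ min rf (1 / 3) →
          Summable (majorantTerm f r) ∧ r + ∑' n, majorantTerm f r n ≤ boundaryDist f) ∧
        -- sharpness
        (rf ≤ 1 / 3 → ∀ r : ℝ, rf < r → r < 1 →
          ∃ f ∈ StarlikeClass φ,
            Summable (majorantTerm f r) ∧ boundaryDist f < r + ∑' n, majorantTerm f r n) := by
  obtain ⟨Q, hQ, hQ0, hQφ⟩ := exists_exponent hφ.analytic hφ.map_zero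
  have hext := hφ.isExtremal hQ hQ0 hQφ
  set h : ℂ → ℂ := fun z => z * Complex.exp (Q z) with hh
  refine ⟨h, hext, fun g hg => eq_mul_exp hg.1.analytic hg.1.map_zero hg.1.deriv_zero
    (hg.1.mul_deriv_eq hg.2) hQ hQ0 hQφ, ?_⟩
  set N : ℝ → ℝ := fun x => x * Real.exp (Q x).re with hN
  have hNmono : StrictMonoOn N (Set.Ioo (-1) 1) := strictMonoOn_mul_exp_re_exponent hφ hQ hQφ
  have hGmono := strictMonoOn_re_exponent hφ hpos hQ hQφ
  have hNcont : ContinuousOn N (Set.Ioo (-1) 1) :=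
    continuousOn_id.mul (continuousOn_re_ofReal hQ).rexp
  have h0mem : (0 : ℝ) ∈ Set.Ioo (-1 : ℝ) 1 := by norm_num
  have hexpQ : ∀ x ∈ Set.Ioo (-1 : ℝ) 1, Complex.exp (Q x) = (Real.exp (Q x).re : ℝ) := by
    intro x hx
    rw [Complex.ofReal_exp]
    congr 1
    exact Complex.ext rfl (by simp [im_exponent_eq_zero hpos hQ hQ0 hQφ hx])
  have hhN : ∀ x ∈ Set.Ioo (-1 : ℝ) 1, h x = (N x : ℝ) := by
    intro x hx
    simp only [hh, hN, hexpQ x hx]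
    push_cast
    rfl
  have hneg : ∀ {x : ℝ}, x ∈ Set.Ioo (0 : ℝ) 1 → -x ∈ Set.Ioo (-1 : ℝ) 1 := fun hx =>
    ⟨by linarith [hx.2], by linarith [hx.1]⟩
  -- `M r = -h (-r)` increases and is bounded by `1`, since `Q (-r) < 0`; its supremum `L` is
  -- therefore the radial limit `-h(-1)`.
  set M : ℝ → ℝ := fun r => -N (-r) with hM
  have hMmono : StrictMonoOn M (Set.Ioo 0 1) := fun x hx y hy hxy =>
    neg_lt_neg (hNmono (hneg hy) (hneg hx) (neg_lt_neg hxy))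
  have hMle : ∀ x ∈ Set.Ioo (0 : ℝ) 1, M x ≤ 1 := by
    intro x hx
    have h1 := hGmono (hneg hx) h0mem (by linarith [hx.1])
    simp only [Complex.ofReal_zero, hQ0, Complex.zero_re] at h1
    have h2 := Real.exp_lt_one_iff.2 h1
    have h3 : M x = x * Real.exp (Q ((-x : ℝ) : ℂ)).re := by simp only [hM, hN]; ring
    rw [h3]
    exact mul_le_one₀ hx.2.le (Real.exp_pos _).le h2.le
  have hMne : (M '' Set.Ioo 0 1).Nonempty := ⟨_, 1 / 2, by norm_num, rfl⟩
  have hMbdd : BddAbove (M '' Set.Ioo 0 1) := ⟨1, by rintro _ ⟨x, hx, rfl⟩; exact hMle x hx⟩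
  set L := sSup (M '' Set.Ioo 0 1) with hL
  have hMlim : Tendsto M (𝓝[<] 1) (𝓝 L) :=
    hMmono.monotoneOn.tendsto_nhdsWithin_Ioo_left (by simp) hMbdd
  have hL1 : L ≤ 1 := csSup_le hMne (by rintro _ ⟨x, hx, rfl⟩; exact hMle x hx)
  have hL0 : 0 < L := by
    refine lt_of_lt_of_le ?_ (le_csSup hMbdd ⟨1 / 2, by norm_num, rfl⟩)
    simp only [hM, hN, neg_mul, neg_neg]
    positivity
  have hhlim : Tendsto (fun r : ℝ => h (-(r : ℂ))) (𝓝[<] 1) (𝓝 (((-L : ℝ)) : ℂ)) := by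
    refine ((Complex.continuous_ofReal.tendsto _).comp hMlim.neg).congr' ?_
    filter_upwards [Ioo_mem_nhdsLT (zero_lt_one (α := ℝ))] with r hr
    have := hhN (-r) (hneg hr)
    rw [Complex.ofReal_neg] at this
    rw [this]
    simp [hM]
  -- For `x ≥ 1/2` one has `h x ≥ x * exp c` with `c = Q (1/2) > 0`; so `x = max (1/2) (exp (-c)) <
  -- 1` gives `h x ≥ 1 ≥ L`, and the intermediate value theorem provides the root.
  obtain ⟨x₁, hx₁, hNx₁⟩ : ∃ x ∈ Set.Ioo (0 : ℝ) 1, L ≤ N x := by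
    have hG := hGmono h0mem (show (1 / 2 : ℝ) ∈ Set.Ioo (-1 : ℝ) 1 by norm_num) (by norm_num)
    simp only [Complex.ofReal_zero, hQ0, Complex.zero_re] at hG
    set c := (Q ((1 / 2 : ℝ) : ℂ)).re with hc
    have hx : max (1 / 2) (Real.exp (-c)) ∈ Set.Ioo (0 : ℝ) 1 :=
      ⟨lt_max_of_lt_left (by norm_num),
        max_lt (by norm_num) (Real.exp_lt_one_iff.2 (neg_lt_zero.2 hG))⟩
    refine ⟨_, hx, hL1.trans ?_⟩
    have h1 := hGmono.monotoneOn (show (1 / 2 : ℝ) ∈ Set.Ioo (-1 : ℝ) 1 by norm_num)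
      (⟨by linarith [hx.1], hx.2⟩ : max (1 / 2) (Real.exp (-c)) ∈ Set.Ioo (-1 : ℝ) 1)
      (le_max_left _ _)
    calc (1 : ℝ) = Real.exp (-c) * Real.exp c := by rw [← Real.exp_add]; simp
      _ ≤ N _ := mul_le_mul (le_max_right _ _) (Real.exp_le_exp.2 h1) (Real.exp_pos _).le hx.1.le
  have hIcc : Set.Icc 0 x₁ ⊆ Set.Ioo (-1 : ℝ) 1 := fun y hy =>
    ⟨by linarith [hy.1], hy.2.trans_lt hx₁.2⟩
  have hN0 : N 0 = 0 := by simp [hN]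
  obtain ⟨rf, hrf, hNrf⟩ := intermediate_value_Icc hx₁.1.le (hNcont.mono hIcc)
    (show L ∈ Set.Icc (N 0) (N x₁) from ⟨by rw [hN0]; exact hL0.le, hNx₁⟩)
  have hrf' := hIcc hrf
  have hrf0 : 0 < rf := lt_of_le_of_ne hrf.1 fun h0 => by
    rw [← h0, hN0] at hNrf
    exact hL0.ne hNrf
  have hroot : ∀ r ∈ Set.Ioo (-1 : ℝ) 1, h r + ((-L : ℝ) : ℂ) = 0 ↔ N r = L := by
    intro r hr
    rw [hhN r hr, ← Complex.ofReal_add, Complex.ofReal_eq_zero]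
    constructor <;> intro h <;> linarith
  refine ⟨((-L : ℝ) : ℂ), rf, hhlim, ⟨⟨hrf0, hrf'.2, (hroot rf hrf').2 hNrf⟩, ?_⟩, ?_, ?_⟩
  · rintro r ⟨hr0, hr1, hr⟩
    have hr' : r ∈ Set.Ioo (-1 : ℝ) 1 := ⟨by linarith, hr1⟩
    exact (hNmono.injOn hrf' hr' (hNrf.trans ((hroot r hr').1 hr).symm)).le
  · intro f hf r hr0 hr
    obtain ⟨q, ω, hω, hmaps, hω0, hq, hq0, hqω, hfq⟩ := hφ.exists_of_mem_starlikeClass hf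
    have hr3 := hr.trans (min_le_right _ _)
    have hrrf := hr.trans (min_le_left _ _)
    have hnn : ∀ n, 0 ≤ majorantTerm f r n := fun n => by
      rw [majorantTerm]; positivity
    have hpart : ∀ n, ∑ i ∈ Finset.range n, majorantTerm f r i ≤ N r - r := by
      intro n
      have h1 := add_sum_majorantTerm hq hq0 hfq r n
      have h2 := mul_le_mul_of_nonneg_left (hφ.majorantSum_exp_le hpos hQ hQ0 hQφ hω hmaps hω0 hq
        hq0 hqω hr0 hr3 n) hr0
      rw [Finset.sum_range_succ] at h1
      have h3 := hnn n
      change _ ≤ N r at h2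
      linarith
    have hNr : N r ≤ L := by
      rw [← hNrf]
      exact hNmono.monotoneOn ⟨by linarith, by linarith⟩ hrf' hrrf
    have hdist : L ≤ boundaryDist f := by
      refine le_boundaryDist hf.1.analytic hf.1.univalent
        (deriv_ne_zero_of_eq_mul_exp hq (hφ.re_one_add hmaps hqω) hfq) hf.1.map_zero ?_
      intro s hs
      obtain ⟨_, ⟨r₀, hr₀, rfl⟩, hsr⟩ := exists_lt_of_lt_csSup hMne hs
      refine ⟨r₀, hr₀.2, fun z hz hzr => hsr.trans_le ?_⟩
      have hz1 : ‖z‖ ∈ Set.Ioo (0 : ℝ) 1 := ⟨hr₀.1.trans hzr, mem_disk.1 hz⟩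
      refine (hMmono hr₀ hz1 hzr).le.trans ?_
      rw [hfq z hz, norm_mul, Complex.norm_exp]
      simp only [hM, hN, neg_mul, neg_neg]
      exact mul_le_mul_of_nonneg_left (Real.exp_le_exp.2
        (hφ.re_exponent_ge hpos hQ hQ0 hQφ hω hmaps hω0 hq hq0 hqω hz)) (norm_nonneg z)
    refine ⟨summable_of_sum_range_le hnn hpart, ?_⟩
    have := Real.tsum_le_of_sum_range_le hnn hpart
    linarith
  -- The extremal function is the witness for every `r`: beyond `rf` its majorant series `h r`
  -- exceeds `L`, which bounds its boundary distance from above.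
  · intro _ r hr hr1
    have hr' : r ∈ Set.Ioo (-1 : ℝ) 1 := ⟨by linarith, hr1⟩
    have hsum := hasSum_majorantTerm_of_nonneg (f := h) hQ hQ0 (fun _ _ => rfl)
      (taylorCoeff_deriv_exponent_nonneg hpos hQ hQφ) hr'
    refine ⟨h, ⟨hext.1, id, differentiableOn_id, Set.mapsTo_id _, rfl, hext.2⟩, hsum.summable, ?_⟩
    have h1 := boundaryDist_le_of_tendsto hext.1.analytic hext.1.univalent
      (deriv_ne_zero_of_eq_mul_exp hQ (hφ.re_one_add (Set.mapsTo_id _) hQφ) fun _ _ => rfl)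
      hext.1.map_zero hhlim
    rw [Complex.norm_real, norm_neg, Real.norm_of_nonneg hL0.le] at h1
    rw [hsum.tsum_eq, hexpQ r hr', Complex.ofReal_re]
    have h2 : N rf < N r := hNmono hrf' hr' hr
    rw [hNrf] at h2
    simp only [hN] at h2
    linarith
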